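/- Identify Minkowski space $\mathbb E^{1,3}$ with the complex Hermitian $2\times2$ matrices, with $\langle\xi,\xi\rangle=-\det\xi$, put $e_1=\mathrm{diag}(1,-1)$ and $\mathbb H^3=\{\xi \text{ Hermitian}: \det\xi=1,\ \operatorname{tr}\xi>0\}$. Let $f:M\to\mathbb H^3$ be a smooth immersion of a connected surface with smooth unit normal $n$ and constant Gaussian curvature $K=-1+\sigma^2$, where $\sigma>0$, $K>-1$ and $K\neq0$; $n$ is chosen so that $\mathrm{I\!I}=-\langle df,dn\rangle$ is positive definite, and $M$ carries the conformal structure of $\mathrm{I\!I}$, oriented so that $(f,n,f_x,f_y)$ is a positive basis of $\mathbb E^{1,3}$ for every conformal coordinate $z=x+iy$. In a conformal coordinate write $$\mathrm I=Q\,dz^2+(e^u+|Q|^2e^{-u})\,dz\,d\bar z+\bar Q\,d\bar z^2,\qquad \mathrm{I\!I}=\sigma(e^u-|Q|^2e^{-u})\,dz\,d\bar z .$$ For $\lambda\in\mathbb C\setminus\{0\}$ an extended frame $\Psi^\lambda$ is a smooth solution with values in $\mathrm{SL}_2\mathbb C$ of $\partial\Psi^\lambda=\Psi^\lambda U^\lambda$,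 $\bar\partial\Psi^\lambda=\Psi^\lambda V^\lambda$ with $$U^\lambda=\begin{pmatrix}\frac14\partial u+p & \frac{i(1+\sigma)}{2}\lambda^{-1}e^{u/2}\\ -\frac{i(1+\sigma)}{2}\lambda^{-1}Qe^{-u/2} & -\frac14\partial u-p\end{pmatrix},\quad V^\lambda=\begin{pmatrix}-\frac14\bar\partial u-\bar p & \frac{i(1-\sigma)}{2}\lambda\bar Qe^{-u/2}\\ -\frac{i(1-\sigma)}{2}\lambda e^{u/2} & \frac14\bar\partial u+\bar p\end{pmatrix},$$ $$p=\frac{-\bar\partial Q+e^{-u}Q\,\partial\bar Q}{2(e^u-|Q|^2e^{-u})}$$ (here $p=0$ because $K$ is constant). Let $f^\lambda,n^\lambda$ $(|\lambda|=1)$ and $L^\lambda$ $(\lambda\neq0)$ be maps on $M$ that are given near every point, by extended frames $\Psi^\lambda$ on a conformal coordinate domain, as $$f^\lambda=\Psi^\lambda(\Psi^\lambda)^*,\qquad n^\lambda=\Psi^\lambda e_1(\Psi^\lambda)^*,\qquad L^\lambda=i\,\Psi^\lambda e_1(\Psi^\lambda)^{-1}$$ (the associated family of $f$, their normals, and the family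 of Lagrangian Gauss maps; for $|\lambda|=1$, $L^\lambda=i\,n^\lambda (f^\lambda)^{-1}$ represents the oriented timelike plane $f^\lambda\wedge n^\lambda$). Let $\lambda_0\in\mathbb C$. (1) Assume $-1<K<0$ and $|\lambda_0|=\exp\big(\operatorname{arcosh}\sqrt{-1/K}\big)$. Then there is a constant $g\in\mathrm{SL}_2\mathbb C$ such that $gL^{\lambda_0}g^{-1}$ is a harmonic local diffeomorphism of $M$ into the hyperbolic plane $\mathbb H^2=\{A\in\mathfrak{su}_{1,1}:\det A=1,\ \operatorname{Im}A_{11}>0\}$ with the metric $\frac12\operatorname{tr}(AB)$. (2) Assume $K>0$ and $|\lambda_0|=\exp\big(\operatorname{arsinh}\sqrt{1/K}\big)$. Then there is a constant $g\in\mathrm{SL}_2\mathbb C$ such that $gL^{\lambda_0}g^{-1}$ is a harmonic local diffeomorphism of $M$ into the two-sphere $\mathbb S^2=\{A\in\mathfrak{su}_2:\det A=1\}$ with the metric $-\frac12\operatorname{tr}(AB)$. Moreover, if $f$, or some $f^\lambda$ with $|\lambda|=1$, is not totally umbilic, then in both cases $gL^{\lambda_0}g^{-1}$ is not conformal. Harmonicity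 and conformality refer to the conformal structure of $\mathrm{I\!I}$ on $M$. -/

import Mathlib

open scoped Manifold ContDiff Matrix

noncomputable section

namespace CGC

/-! ### The matrix model of Minkowski four-space and of hyperbolic three-space -/

/-- Complex `2 × 2` matrices. The Hermitian ones form the Minkowski space `𝔼^{1,3}`;
all of them form its complexification. -/
abbrev Mat2 := Matrix (Fin 2) (Fin 2) ℂ

/-- Basis vector `e₁` of Minkowski space (and `e₀` is the identity matrix). -/
def e1 : Mat2 := !![1, 0; 0, -1]

/-- Basis vector `e₂` of Minkowski space; `e₃` is `!![0, 1; 1, 0]`. -/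
def e2 : Mat2 := !![0, -Complex.I; Complex.I, 0]

/-- The null vector `-(e₂ - i e₃) / 2`. -/
def ehat2 : Mat2 := !![0, Complex.I; 0, 0]

/-- The null vector `-(e₂ + i e₃) / 2`. -/
def ehat3 : Mat2 := !![0, 0; -Complex.I, 0]

/-- The Lorentzian inner product `-(1/2) tr (ξ e₂ ᵗη e₂)`, complex bilinear;
it is real on Hermitian matrices, with `⟨ξ, ξ⟩ = - det ξ`. -/
def lorentz (ξ η : Mat2) : ℂ := -(1 / 2) * (ξ * e2 * ηᵀ * e2).trace

/-- `ℍ³`: Hermitian matrices of determinant one and positive trace. -/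
def hyperbolicSpace : Set Mat2 :=
  {ξ | ξ.IsHermitian ∧ ξ.det = 1 ∧ 0 < ξ.trace.re}

/-- The coordinates of a Hermitian matrix in the basis `e₀, e₁, e₂, e₃`. -/
def minkowskiCoord (ξ : Mat2) : Fin 4 → ℝ :=
  ![((ξ 0 0 + ξ 1 1) / 2).re, ((ξ 0 0 - ξ 1 1) / 2).re, (ξ 1 0).im, (ξ 1 0).re]

/-- The oriented timelike plane `x ∧ v` spanned by orthonormal `x ∈ ℍ³` and `v`, as a point of
`Geo(ℍ³) = SL₂ℂ / GL₁ℂ`, realized as the adjoint orbit of `i e₁`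
(trace-free matrices of determinant one). It is the equivariant map with `e₀ ∧ e₁ ↦ i e₁`. -/
def wedge (x v : Mat2) : Mat2 := Complex.I • (v * x⁻¹)

theorem wedge_frame (Ψ : Mat2) (h : Ψ.det = 1) :
    wedge (Ψ * Ψᴴ) (Ψ * e1 * Ψᴴ) = Complex.I • (Ψ * e1 * Ψ⁻¹) := by
  have h1 : IsUnit (Ψᴴ).det := by
    rw [Matrix.det_conjTranspose, h]; simp
  unfold wedge
  rw [Matrix.mul_inv_rev]
  congr 1
  rw [Matrix.mul_assoc (Ψ * e1), ← Matrix.mul_assoc (Ψᴴ), Matrix.mul_nonsing_inv _ h1,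
    Matrix.one_mul]

/-! ### Derivatives in a coordinate `z = x + i y` -/

variable {M : Type*} [TopologicalSpace M]

/-- Derivative of a vector-valued function in the constant direction `v` of the coordinate `e`:
`v = 1` gives `∂/∂x` and `v = i` gives `∂/∂y`. -/
def cderiv {E : Type*} [NormedAddCommGroup E] [NormedSpace ℝ E]
    (e : OpenPartialHomeomorph M ℂ) (v : ℂ) (g : M → E) (p : M) : E :=
  fderiv ℝ (g ∘ e.symm) (e p) v

/-- `∂ = (1/2) (∂/∂x - i ∂/∂y)` on functions. -/
def dz (e : OpenPartialHomeomorph M ℂ) (g : M → ℂ) (p : M) : ℂ :=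
  (1 / 2) * (cderiv e 1 g p - Complex.I * cderiv e Complex.I g p)

/-- `∂̄ = (1/2) (∂/∂x + i ∂/∂y)` on functions. -/
def dzbar (e : OpenPartialHomeomorph M ℂ) (g : M → ℂ) (p : M) : ℂ :=
  (1 / 2) * (cderiv e 1 g p + Complex.I * cderiv e Complex.I g p)

/-- Entrywise directional derivative of a matrix-valued function. -/
def mderiv (e : OpenPartialHomeomorph M ℂ) (v : ℂ) (A : M → Mat2) (p : M) : Mat2 :=
  Matrix.of fun i j => cderiv e v (fun q => A q i j) p

/-- Entrywise `∂`. -/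
def mdz (e : OpenPartialHomeomorph M ℂ) (A : M → Mat2) (p : M) : Mat2 :=
  Matrix.of fun i j => dz e (fun q => A q i j) p

/-- Entrywise `∂̄`. -/
def mdzbar (e : OpenPartialHomeomorph M ℂ) (A : M → Mat2) (p : M) : Mat2 :=
  Matrix.of fun i j => dzbar e (fun q => A q i j) p

/-! ### Surfaces in hyperbolic three-space -/

/-- First fundamental form `⟨df, df⟩` on the coordinate directions `v, w`. -/
def fundI (e : OpenPartialHomeomorph M ℂ) (f : M → Mat2) (v w : ℂ) (p : M) : ℝ :=
  (lorentz (mderiv e v f p) (mderiv e w f p)).re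

/-- Second fundamental form `-⟨df, dn⟩` on the coordinate directions `v, w`. -/
def fundII (e : OpenPartialHomeomorph M ℂ) (f n : M → Mat2) (v w : ℂ) (p : M) : ℝ :=
  -(lorentz (mderiv e v f p) (mderiv e w n p)).re

/-- Gaussian curvature `K = -1 + det II / det I` of a surface in `ℍ³`. -/
def gaussCurvature (e : OpenPartialHomeomorph M ℂ) (f n : M → Mat2) (p : M) : ℝ :=
  -1 + (fundII e f n 1 1 p * fundII e f n Complex.I Complex.I p
          - fundII e f n 1 Complex.I p ^ 2) /
       (fundI e f 1 1 p * fundI e f Complex.I Complex.I p - fundI e f 1 Complex.I p ^ 2)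

variable [ChartedSpace ℂ M]

/-- `f : M → ℍ³` is a smooth immersion of the smooth surface `M`, and `n` is a smooth
unit normal field along it. -/
structure IsSurface (f n : M → Mat2) : Prop where
  smooth_f : ∀ i j, ContMDiff 𝓘(ℝ, ℂ) 𝓘(ℝ, ℂ) ∞ fun p => f p i j
  smooth_n : ∀ i j, ContMDiff 𝓘(ℝ, ℂ) 𝓘(ℝ, ℂ) ∞ fun p => n p i j
  mem_hyperbolicSpace : ∀ p, f p ∈ hyperbolicSpace
  immersion : ∀ e ∈ IsManifold.maximalAtlas 𝓘(ℝ, ℂ) ∞ M, ∀ p ∈ e.source,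
    LinearIndependent ℝ ![mderiv e 1 f p, mderiv e Complex.I f p]
  normal_hermitian : ∀ p, (n p).IsHermitian
  normal_unit : ∀ p, lorentz (n p) (n p) = 1
  normal_tangent : ∀ p, lorentz (f p) (n p) = 0
  normal_orth : ∀ e ∈ IsManifold.maximalAtlas 𝓘(ℝ, ℂ) ∞ M, ∀ p ∈ e.source, ∀ v : ℂ,
    lorentz (mderiv e v f p) (n p) = 0

/-- The surface has constant Gaussian curvature `K`. -/
def HasConstantCurvature (f n : M → Mat2) (K : ℝ) : Prop :=
  ∀ e ∈ IsManifold.maximalAtlas 𝓘(ℝ, ℂ) ∞ M, ∀ p ∈ e.source, gaussCurvature e f n p = K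

/-- The surface is totally umbilic: at every point `II = μ I` for some number `μ`. -/
def IsTotallyUmbilic (f n : M → Mat2) : Prop :=
  ∀ p : M, ∀ e ∈ IsManifold.maximalAtlas 𝓘(ℝ, ℂ) ∞ M, p ∈ e.source →
    ∃ μ : ℝ, ∀ v w : ℂ, fundII e f n v w p = μ * fundI e f v w p

/-- `e` is a conformal coordinate `z = x + i y` for the second conformal structure: the second
fundamental form is a positive multiple of `dx² + dy²`, and `z` is positive for the orientation
determined by the unit normal, that is, `(f, n, f_x, f_y)` is a positive basis. -/
structure IsConformalCoord (f n : M → Mat2) (e : OpenPartialHomeomorph M ℂ) : Prop where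
  mem_atlas : e ∈ IsManifold.maximalAtlas 𝓘(ℝ, ℂ) ∞ M
  diag : ∀ p ∈ e.source, fundII e f n 1 1 p = fundII e f n Complex.I Complex.I p
  off_diag : ∀ p ∈ e.source, fundII e f n 1 Complex.I p = 0
  pos : ∀ p ∈ e.source, 0 < fundII e f n 1 1 p
  oriented : ∀ p ∈ e.source, 0 < (Matrix.of ![minkowskiCoord (f p), minkowskiCoord (n p),
    minkowskiCoord (mderiv e 1 f p), minkowskiCoord (mderiv e Complex.I f p)]).det

/-! ### The Lax pair with spectral parameter -/

/-- The coefficient `Q = ⟨∂f, ∂f⟩` of the Klotz differential. -/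
def klotz (e : OpenPartialHomeomorph M ℂ) (f : M → Mat2) (p : M) : ℂ :=
  lorentz (mdz e f p) (mdz e f p)

/-- `σ > 0` with `K = -1 + σ²`. -/
def sigma (K : ℝ) : ℝ := √(1 + K)

/-- The function `u` with `e^u = ℓ + m / σ`, where `ℓ = ⟨∂f, ∂̄f⟩` and `m = -⟨∂f, ∂̄n⟩`, that is,
`I = Q dz² + 2 ℓ dz dz̄ + Q̄ dz̄²` and `II = 2 m dz dz̄`. -/
def uFun (e : OpenPartialHomeomorph M ℂ) (f n : M → Mat2) (K : ℝ) (p : M) : ℝ :=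
  Real.log ((lorentz (mdz e f p) (mdzbar e f p)).re
    + (-(lorentz (mdz e f p) (mdzbar e n p)).re) / sigma K)

/-- `p = (1/2) (-∂̄Q + e^{-u} Q ∂Q̄) (e^u - |Q|² e^{-u})⁻¹`. -/
def pFun (e : OpenPartialHomeomorph M ℂ) (f n : M → Mat2) (K : ℝ) (p : M) : ℂ :=
  (1 / 2) * (-dzbar e (klotz e f) p
      + (Real.exp (-uFun e f n K p) : ℂ) * klotz e f p
        * dz e (fun q => starRingEnd ℂ (klotz e f q)) p)
    * ((Real.exp (uFun e f n K p) - ‖klotz e f p‖ ^ 2 * Real.exp (-uFun e f n K p) : ℝ) : ℂ)⁻¹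

/-- The matrix `U^λ`. -/
def laxU (e : OpenPartialHomeomorph M ℂ) (f n : M → Mat2) (K : ℝ) (lam : ℂ) (p : M) : Mat2 :=
  ((1 / 4) * dz e (fun q => (uFun e f n K q : ℂ)) p + pFun e f n K p) • e1
    + (((1 + sigma K) / 2 : ℂ) * lam⁻¹) •
      ((Real.exp (uFun e f n K p / 2) : ℂ) • ehat2
        + (klotz e f p * (Real.exp (-uFun e f n K p / 2) : ℂ)) • ehat3)

/-- The matrix `V^λ`. -/
def laxV (e : OpenPartialHomeomorph M ℂ) (f n : M → Mat2) (K : ℝ) (lam : ℂ) (p : M) : Mat2 :=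
  (-((1 / 4) * dzbar e (fun q => (uFun e f n K q : ℂ)) p
      + starRingEnd ℂ (pFun e f n K p))) • e1
    + (((1 - sigma K) / 2 : ℂ) * lam) •
      ((starRingEnd ℂ (klotz e f p) * (Real.exp (-uFun e f n K p / 2) : ℂ)) • ehat2
        + (Real.exp (uFun e f n K p / 2) : ℂ) • ehat3)

/-- `Ψ` is an extended frame, at the value `λ` of the spectral parameter, of the surface `f` with
normal `n` on the domain of the coordinate `e`: it is smooth with values in `SL₂ℂ` and solves
`∂Ψ = Ψ U^λ`, `∂̄Ψ = Ψ V^λ`. The initial value (a constant factor on the left) is left free. -/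
structure IsExtendedFrame (f n : M → Mat2) (K : ℝ) (e : OpenPartialHomeomorph M ℂ) (lam : ℂ)
    (Ψ : M → Mat2) : Prop where
  smooth : ∀ i j, ContMDiffOn 𝓘(ℝ, ℂ) 𝓘(ℝ, ℂ) ∞ (fun p => Ψ p i j) e.source
  det_eq_one : ∀ p ∈ e.source, (Ψ p).det = 1
  lax_z : ∀ p ∈ e.source, mdz e Ψ p = Ψ p * laxU e f n K lam p
  lax_zbar : ∀ p ∈ e.source, mdzbar e Ψ p = Ψ p * laxV e f n K lam p

/-- `F λ` and `N λ`, for `|λ| = 1`, are the associated family of surfaces of `f` and their unit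
normals, and `L λ`, for every `λ ≠ 0`, is the associated family of Lagrangian Gauss maps: near
every point there are a conformal coordinate and extended frames `Ψ^λ` with
`f^λ = Ψ^λ e₀ (Ψ^λ)^*`, `n^λ = Ψ^λ e₁ (Ψ^λ)^*` and `L^λ = i Ψ^λ e₁ (Ψ^λ)⁻¹`. For `|λ| = 1` the last
expression is `f^λ ∧ n^λ`, by `wedge_frame`. -/
def IsAssociatedFamily (f n : M → Mat2) (K : ℝ) (F N L : ℂ → M → Mat2) : Prop :=
  ∀ p : M, ∃ e : OpenPartialHomeomorph M ℂ, IsConformalCoord f n e ∧ p ∈ e.source ∧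
    ∃ Ψ : ℂ → M → Mat2, ∀ lam : ℂ, lam ≠ 0 →
      IsExtendedFrame f n K e lam (Ψ lam) ∧
      ∀ q ∈ e.source,
        (‖lam‖ = 1 → F lam q = Ψ lam q * (Ψ lam q)ᴴ ∧ N lam q = Ψ lam q * e1 * (Ψ lam q)ᴴ) ∧
        L lam q = Complex.I • (Ψ lam q * e1 * (Ψ lam q)⁻¹)

/-! ### Maps into the sphere and into the hyperbolic plane

For the sign `s = 1` (sphere) or `s = -1` (hyperbolic plane), `ℝ³` carries the bilinear form
`s x₀ y₀ + x₁ y₁ + x₂ y₂`, and it is identified isometrically with `𝔰𝔲₂` (inner product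
`-(1/2) tr AB`), respectively with `𝔰𝔲₁,₁` (inner product `(1/2) tr AB`). -/

/-- The bilinear form `s x₀ y₀ + x₁ y₁ + x₂ y₂`. -/
def form (s : ℝ) (x y : Fin 3 → ℝ) : ℝ := s * x 0 * y 0 + x 1 * y 1 + x 2 * y 2

/-- The matrix of `𝔰𝔲₂` (for `s = 1`) or `𝔰𝔲₁,₁` (for `s = -1`) that corresponds to `x`. The quadric
`S2`, respectively `H2`, becomes the adjoint orbit of `i e₁`. -/
def toLieAlg (s : ℝ) (x : Fin 3 → ℝ) : Mat2 :=
  !![Complex.I * x 0, x 1 + Complex.I * x 2;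
     -s * (x 1 - Complex.I * x 2), -(Complex.I * x 0)]

/-- The unit two-sphere. -/
def S2 : Set (Fin 3 → ℝ) := {x | form 1 x x = 1}

/-- The hyperbolic plane (upper sheet of the hyperboloid). -/
def H2 : Set (Fin 3 → ℝ) := {x | form (-1) x x = -1 ∧ 0 < x 0}

/-- `φ` is a local diffeomorphism from `M` into the surface `N ⊂ ℝ³`: it is smooth with values
in `N`, and near every point it has a smooth inverse on a relatively open part `N ∩ W` of `N`. -/
def IsLocalDiffeoInto (N : Set (Fin 3 → ℝ)) (φ : M → Fin 3 → ℝ) : Prop :=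
  ContMDiff 𝓘(ℝ, ℂ) 𝓘(ℝ, Fin 3 → ℝ) ∞ φ ∧ (∀ p, φ p ∈ N) ∧
  ∀ p : M, ∃ U : Set M, ∃ W : Set (Fin 3 → ℝ), ∃ ψ : (Fin 3 → ℝ) → M,
    IsOpen U ∧ p ∈ U ∧ IsOpen W ∧ Set.MapsTo φ U W ∧ Set.MapsTo ψ (N ∩ W) U ∧
    ContMDiffOn 𝓘(ℝ, Fin 3 → ℝ) 𝓘(ℝ, ℂ) ∞ ψ W ∧
    (∀ q ∈ U, ψ (φ q) = q) ∧ ∀ x ∈ N ∩ W, φ (ψ x) = x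

/-- The coordinate Laplacian `φ_xx + φ_yy`. -/
def laplacian (e : OpenPartialHomeomorph M ℂ) (φ : M → Fin 3 → ℝ) (p : M) : Fin 3 → ℝ :=
  cderiv e 1 (cderiv e 1 φ) p + cderiv e Complex.I (cderiv e Complex.I φ) p

/-- Harmonicity, for the second conformal structure of the surface `(f, n)`, of a map `φ` into the
quadric `⟨x, x⟩ = s` with the induced metric. The tangent space of the quadric at `x` is the
orthogonal complement of `x` and its Levi-Civita connection is the tangential part of the flat
one, so the tension field is, up to a positive factor, the tangential part of the Laplacian. -/
def IsHarmonic (f n : M → Mat2) (s : ℝ) (φ : M → Fin 3 → ℝ) : Prop :=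
  ∀ e, IsConformalCoord f n e → ∀ p ∈ e.source, ∀ X : Fin 3 → ℝ,
    form s X (φ p) = 0 → form s (laplacian e φ p) X = 0

/-- Conformality, for the second conformal structure of the surface `(f, n)`: at every point the
pulled back metric is a multiple of `dx² + dy²` in conformal coordinates. -/
def IsConformal (f n : M → Mat2) (s : ℝ) (φ : M → Fin 3 → ℝ) : Prop :=
  ∀ e, IsConformalCoord f n e → ∀ p ∈ e.source,
    form s (cderiv e 1 φ p) (cderiv e 1 φ p)
        = form s (cderiv e Complex.I φ p) (cderiv e Complex.I φ p) ∧
      form s (cderiv e 1 φ p) (cderiv e Complex.I φ p) = 0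

end CGC

end

noncomputable section

namespace CGC

/-! ### Calculus in a coordinate -/

section Calculus

variable {M : Type*} [TopologicalSpace M]
variable {E : Type*} [NormedAddCommGroup E] [NormedSpace ℝ E]
variable {E' : Type*} [NormedAddCommGroup E'] [NormedSpace ℝ E']

/-! Put τ = (1-σ)/(1+σ). Factoring out (1+σ)/2, the Lax pair becomes one connection form W = Ψ⁻¹dΨ
with diagonal part d dz - d̄ dz̄ and off-diagonal entries λ⁻¹α dz + λτβ̄ dz̄ and λ⁻¹β dz + λτᾱ dz̄
(`connForm`, `connForm_lax`). If |λ|²τ = -s with s = ±1, the lower entry is -s times the conjugate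
of the upper one, so W takes values in the Lie algebra of the unitary group of E = diag(1, s), which
is 𝔰𝔲₂ or 𝔰𝔲₁,₁ (`connForm_skew`). The two prescribed radii |λ₀| are exactly the solutions of |λ|²τ
= 1 for K < 0 and |λ|²τ = -1 for K > 0.

Consequently ΨEΨ* is locally constant for every local frame. Frames over different coordinates are
related only through the common map L, and the nontrivial global point is that L alone determines
ΨEΨ* (`herm_unique`). On the connected surface this gives a single Hermitian form; conjugating it to
E by a constant g puts gΨ into the unitary group and gLg⁻¹ into the adjoint orbit of i e₁.

The geometric claims are read off from dL·Ψ = iΨ[W, e₁]. Harmonicity: the zero curvature equation at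
two values of λ separates by powers of λ and makes α and β holomorphic up to the diagonal gauge,
which leaves the Laplacian of L proportional to L (`laplacian_gauss`). Immersion: off-diagonal
degeneracy would force |α| = |β|, that is e^u = |Q|, contradicting the positivity of II
(`norm_laxA_ne_norm_laxB`). Conformality: the Hopf differential of L is a nonzero multiple of λ⁻²αβ
dz², α never vanishes, and β = 0 means Q = 0, hence an umbilic point, for f and for each f^λ with
|λ| = 1. -/

/-- `g` is smooth on the domain of the coordinate `e`, when read in that coordinate. -/
def SmoothIn (e : OpenPartialHomeomorph M ℂ) (g : M → E) : Prop :=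
  ContDiffOn ℝ ∞ (g ∘ e.symm) e.target

variable {e : OpenPartialHomeomorph M ℂ}

theorem SmoothIn.contDiffAt {g : M → E} (hg : SmoothIn e g) {p : M} (hp : p ∈ e.source) :
    ContDiffAt ℝ ∞ (g ∘ e.symm) (e p) :=
  ContDiffOn.contDiffAt hg (e.open_target.mem_nhds (e.map_source hp))

theorem SmoothIn.differentiableAt {g : M → E} (hg : SmoothIn e g) {p : M} (hp : p ∈ e.source) :
    DifferentiableAt ℝ (g ∘ e.symm) (e p) :=
  (hg.contDiffAt hp).differentiableAt (by simp)

theorem cderiv_add_dir (v w : ℂ) (g : M → E) (p : M) :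
    cderiv e (v + w) g p = cderiv e v g p + cderiv e w g p := by simp [cderiv]

theorem cderiv_smul_dir (r : ℝ) (v : ℂ) (g : M → E) (p : M) :
    cderiv e (r • v) g p = r • cderiv e v g p := by
  unfold cderiv; rw [map_smul]

theorem cderiv_dir (v : ℂ) (g : M → E) (p : M) :
    cderiv e v g p = v.re • cderiv e 1 g p + v.im • cderiv e Complex.I g p := by
  rw [← cderiv_smul_dir, ← cderiv_smul_dir, ← cderiv_add_dir]
  congr 1
  simp

theorem comp_symm_eventuallyEq {X : Type*} {g h : M → X} {p : M} (hp : p ∈ e.source)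
    (hgh : ∀ᶠ q in nhds p, g q = h q) : g ∘ e.symm =ᶠ[nhds (e p)] h ∘ e.symm := by
  have h1 : Filter.Tendsto e.symm (nhds (e p)) (nhds p) := by
    have := e.continuousAt_symm (e.map_source hp)
    rwa [ContinuousAt, e.left_inv hp] at this
  exact h1.eventually hgh

theorem cderiv_congr {g h : M → E} {p : M} (hp : p ∈ e.source)
    (hgh : ∀ᶠ q in nhds p, g q = h q) (v : ℂ) : cderiv e v g p = cderiv e v h p := by
  unfold cderiv
  rw [(comp_symm_eventuallyEq hp hgh).fderiv_eq]

theorem cderiv_congr_on {g h : M → E} {p : M} (hp : p ∈ e.source)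
    (hgh : ∀ q ∈ e.source, g q = h q) (v : ℂ) : cderiv e v g p = cderiv e v h p :=
  cderiv_congr hp (Filter.eventually_of_mem (e.open_source.mem_nhds hp) hgh) v

theorem SmoothIn.congr {g h : M → E} (hg : SmoothIn e g) (hgh : ∀ q ∈ e.source, h q = g q) :
    SmoothIn e h :=
  ContDiffOn.congr hg fun _ hz => hgh _ (e.map_target hz)

theorem cderiv_const (c : E) (v : ℂ) (p : M) : cderiv e v (fun _ => c) p = 0 := by
  have : (fun _ : M => c) ∘ e.symm = fun _ => c := rfl
  simp [cderiv, this]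

theorem SmoothIn.const (c : E) : SmoothIn e fun _ => c := contDiffOn_const

theorem SmoothIn.add {g h : M → E} (hg : SmoothIn e g) (hh : SmoothIn e h) :
    SmoothIn e fun q => g q + h q := ContDiffOn.add hg hh

theorem SmoothIn.clm {g : M → E} (hg : SmoothIn e g) (T : E →L[ℝ] E') :
    SmoothIn e fun q => T (g q) := T.contDiff.comp_contDiffOn hg

theorem SmoothIn.mul {g h : M → ℂ} (hg : SmoothIn e g) (hh : SmoothIn e h) :
    SmoothIn e fun q => g q * h q := ContDiffOn.mul hg hh

theorem cderiv_add {g h : M → E} (hg : SmoothIn e g) (hh : SmoothIn e h) {p : M}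
    (hp : p ∈ e.source) (v : ℂ) :
    cderiv e v (fun q => g q + h q) p = cderiv e v g p + cderiv e v h p := by
  have := fderiv_add (hg.differentiableAt hp) (hh.differentiableAt hp)
  exact congrArg (fun T => T v) this

theorem cderiv_clm {g : M → E} (hg : SmoothIn e g) {p : M}
    (hp : p ∈ e.source) (T : E →L[ℝ] E') (v : ℂ) :
    cderiv e v (fun q => T (g q)) p = T (cderiv e v g p) := by
  have := (T.hasFDerivAt.comp (e p) (hg.differentiableAt hp).hasFDerivAt).fderiv
  exact congrArg (fun T => T v) this

theorem cderiv_mul {g h : M → ℂ} (hg : SmoothIn e g) (hh : SmoothIn e h) {p : M}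
    (hp : p ∈ e.source) (v : ℂ) :
    cderiv e v (fun q => g q * h q) p = cderiv e v g p * h p + g p * cderiv e v h p := by
  have := fderiv_mul (hg.differentiableAt hp) (hh.differentiableAt hp)
  have h2 := congrArg (fun T => T v) this
  have e1 : e.symm (e p) = p := e.left_inv hp
  simp only [_root_.add_apply, _root_.smul_apply, smul_eq_mul,
    Function.comp, e1] at h2
  refine Eq.trans h2 ?_
  simp only [cderiv, Function.comp_def]
  ring

theorem cderiv_conj (g : M → ℂ) (v : ℂ) (p : M) :
    cderiv e v (fun q => starRingEnd ℂ (g q)) p = starRingEnd ℂ (cderiv e v g p) := by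
  have := Complex.conjCLE.comp_fderiv (f := g ∘ e.symm) (x := e p)
  exact congrArg (fun T => T v) this

theorem SmoothIn.conj {g : M → ℂ} (hg : SmoothIn e g) :
    SmoothIn e fun q => starRingEnd ℂ (g q) := hg.clm Complex.conjCLE.toContinuousLinearMap

theorem SmoothIn.cderiv {g : M → E} (hg : SmoothIn e g) (v : ℂ) :
    SmoothIn e (cderiv e v g) := by
  have h1 := ContDiffOn.fderiv_of_isOpen (m := ∞) hg e.open_target (by simp)
  have h2 : ContDiffOn ℝ ∞ (fun z => fderiv ℝ (g ∘ e.symm) z v) e.target :=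
    h1.clm_apply contDiffOn_const
  refine h2.congr fun z hz => ?_
  simp [CGC.cderiv, e.right_inv hz]

/-- Iterated coordinate derivatives as second derivatives in the plane. -/
theorem cderiv_cderiv {g : M → E} (hg : SmoothIn e g) {p : M} (hp : p ∈ e.source) (v w : ℂ) :
    cderiv e v (cderiv e w g) p = fderiv ℝ (fderiv ℝ (g ∘ e.symm)) (e p) v w := by
  have h1 := ContDiffOn.fderiv_of_isOpen (m := ∞) hg e.open_target (by simp)
  have h2 : DifferentiableAt ℝ (fderiv ℝ (g ∘ e.symm)) (e p) :=
    (h1.contDiffAt (e.open_target.mem_nhds (e.map_source hp))).differentiableAt (by simp)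
  have h3 : cderiv e w g ∘ e.symm =ᶠ[nhds (e p)] fun z => fderiv ℝ (g ∘ e.symm) z w := by
    refine Filter.eventually_of_mem (e.open_target.mem_nhds (e.map_source hp)) fun z hz => ?_
    simp [CGC.cderiv, e.right_inv hz]
  have h4 := (h2.hasFDerivAt.clm_apply (hasFDerivAt_const w (e p))).fderiv
  change fderiv ℝ (cderiv e w g ∘ e.symm) (e p) v = _
  rw [h3.fderiv_eq, h4]
  simp

theorem cderiv_comm {g : M → E} (hg : SmoothIn e g) {p : M} (hp : p ∈ e.source) (v w : ℂ) :
    cderiv e v (cderiv e w g) p = cderiv e w (cderiv e v g) p := by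
  rw [cderiv_cderiv hg hp, cderiv_cderiv hg hp]
  exact (hg.contDiffAt hp).isSymmSndFDerivAt
    (by simpa using WithTop.coe_le_coe.2 (le_top : (2 : ℕ∞) ≤ ⊤)) v w

theorem SmoothIn.of_contMDiffOn [ChartedSpace ℂ M] {g : M → E}
    (he : e ∈ IsManifold.maximalAtlas 𝓘(ℝ, ℂ) ∞ M)
    (hg : ContMDiffOn 𝓘(ℝ, ℂ) 𝓘(ℝ, E) ∞ g e.source) : SmoothIn e g :=
  contMDiffOn_iff_contDiffOn.1
    (hg.comp (contMDiffOn_symm_of_mem_maximalAtlas he) fun _ hz => e.map_target hz)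

theorem SmoothIn.contMDiffOn [ChartedSpace ℂ M] {g : M → E}
    (he : e ∈ IsManifold.maximalAtlas 𝓘(ℝ, ℂ) ∞ M)
    (hg : SmoothIn e g) : ContMDiffOn 𝓘(ℝ, ℂ) 𝓘(ℝ, E) ∞ g e.source := by
  have h1 := (contMDiffOn_iff_contDiffOn.2 hg).comp (contMDiffOn_of_mem_maximalAtlas he)
    fun _ hz => e.map_source hz
  exact h1.congr fun q hq => by simp [e.left_inv hq]

/-- A function with vanishing coordinate derivatives is locally constant. -/
theorem SmoothIn.eventually_eq {g : M → E} (hg : SmoothIn e g)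
    (h0 : ∀ q ∈ e.source, ∀ v, CGC.cderiv e v g q = 0) {p : M} (hp : p ∈ e.source) :
    ∀ᶠ q in nhds p, q ∈ e.source ∧ g q = g p := by
  obtain ⟨r, hr, hb⟩ := Metric.isOpen_iff.1 e.open_target (e p) (e.map_source hp)
  have hc : ∀ z ∈ Metric.ball (e p) r, (g ∘ e.symm) z = (g ∘ e.symm) (e p) := by
    intro z hz
    refine Metric.isOpen_ball.is_const_of_fderiv_eq_zero (𝕜 := ℝ)
      (convex_ball _ _).isPreconnected ((ContDiffOn.mono hg hb).differentiableOn (by simp))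
      (fun w hw => ?_) hz (Metric.mem_ball_self hr)
    ext v
    have := h0 _ (e.map_target (hb hw)) v
    rwa [CGC.cderiv, e.right_inv (hb hw)] at this
  have hn := (e.continuousAt hp).preimage_mem_nhds (Metric.ball_mem_nhds (e p) hr)
  filter_upwards [hn, e.open_source.mem_nhds hp] with q hq hqe
  refine ⟨hqe, ?_⟩
  simpa [e.left_inv hqe, e.left_inv hp] using hc _ hq

/-! ### Change of coordinate -/

/-- The coordinate change from `e'` to `e`. -/
def coordChange (e e' : OpenPartialHomeomorph M ℂ) : ℂ → ℂ := e ∘ e'.symm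

/-- The domain of the coordinate change from `e'` to `e`. -/
def coordDomain (e e' : OpenPartialHomeomorph M ℂ) : Set ℂ := e'.target ∩ e'.symm ⁻¹' e.source

theorem isOpen_coordDomain (e e' : OpenPartialHomeomorph M ℂ) : IsOpen (coordDomain e e') :=
  e'.isOpen_inter_preimage_symm e.open_source

theorem contDiffOn_coordChange [ChartedSpace ℂ M] {e e' : OpenPartialHomeomorph M ℂ}
    (he : e ∈ IsManifold.maximalAtlas 𝓘(ℝ, ℂ) ∞ M)
    (he' : e' ∈ IsManifold.maximalAtlas 𝓘(ℝ, ℂ) ∞ M) :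
    ContDiffOn ℝ ∞ (coordChange e e') (coordDomain e e') := by
  have h1 := contMDiffOn_of_mem_maximalAtlas he
  have h2 := contMDiffOn_symm_of_mem_maximalAtlas he'
  exact contMDiffOn_iff_contDiffOn.1 (h1.comp' h2)

theorem mem_coordDomain {e e' : OpenPartialHomeomorph M ℂ} {p : M} (hp : p ∈ e.source)
    (hp' : p ∈ e'.source) : e' p ∈ coordDomain e e' :=
  ⟨e'.map_source hp', by simpa [e'.left_inv hp'] using hp⟩

theorem comp_coordChange {X : Type*} {e e' : OpenPartialHomeomorph M ℂ} (g : M → X) {z : ℂ}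
    (hz : z ∈ coordDomain e e') : (g ∘ e.symm) (coordChange e e' z) = (g ∘ e'.symm) z := by
  simp [coordChange, e.left_inv hz.2]

theorem comp_coordChange_eventuallyEq {X : Type*} {e e' : OpenPartialHomeomorph M ℂ}
    (g : M → X) {z : ℂ} (hz : z ∈ coordDomain e e') : g ∘ e'.symm =ᶠ[nhds z] (g ∘ e.symm) ∘ coordChange e e' :=
  Filter.eventually_of_mem ((isOpen_coordDomain e e').mem_nhds hz)
    fun _ hw => (comp_coordChange g hw).symm

/-- The chain rule for a change of coordinate. -/
theorem cderiv_coordChange [ChartedSpace ℂ M] {e e' : OpenPartialHomeomorph M ℂ}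
    (he : e ∈ IsManifold.maximalAtlas 𝓘(ℝ, ℂ) ∞ M)
    (he' : e' ∈ IsManifold.maximalAtlas 𝓘(ℝ, ℂ) ∞ M) {g : M → E} (hg : SmoothIn e g) {p : M}
    (hp : p ∈ e.source) (hp' : p ∈ e'.source) (v : ℂ) :
    cderiv e' v g p = cderiv e (fderiv ℝ (coordChange e e') (e' p) v) g p := by
  have hz := mem_coordDomain hp hp'
  have h1 : DifferentiableAt ℝ (coordChange e e') (e' p) :=
    ((contDiffOn_coordChange he he').contDiffAt
      ((isOpen_coordDomain e e').mem_nhds hz)).differentiableAt (by simp)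
  have h2 : coordChange e e' (e' p) = e p := by simp [coordChange, e'.left_inv hp']
  have h3 : DifferentiableAt ℝ (g ∘ e.symm) (coordChange e e' (e' p)) := by
    rw [h2]; exact hg.differentiableAt hp
  unfold cderiv
  rw [(comp_coordChange_eventuallyEq g hz).fderiv_eq, fderiv_comp _ h3 h1, h2]
  rfl

/-- The second derivative in a coordinate that depends holomorphically on `e`. -/
theorem cderiv_cderiv_coordChange {e e' : OpenPartialHomeomorph M ℂ}
    {g : M → E} (hg : SmoothIn e g)
    {p : M} (hp : p ∈ e.source) (hp' : p ∈ e'.source)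
    (hhol : DifferentiableOn ℂ (coordChange e e') (coordDomain e e')) :
    ∃ c b : ℂ, ∀ v : ℂ, cderiv e' v (cderiv e' v g) p =
      cderiv e (v * c) (cderiv e (v * c) g) p + cderiv e (v * v * b) g p := by
  set τ := coordChange e e' with hτ
  set D := coordDomain e e'
  have hD : IsOpen D := isOpen_coordDomain e e'
  have hz := mem_coordDomain hp hp'
  have h2 : τ (e' p) = e p := by simp [hτ, coordChange, e'.left_inv hp']
  have hmaps : ∀ z ∈ D, τ z ∈ e.target := fun z hz => e.map_source hz.2
  have hτd : ∀ z ∈ D, HasFDerivAt τ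
      ((ContinuousLinearMap.toSpanSingleton ℂ (deriv τ z)).restrictScalars ℝ) z := fun z hz =>
    ((hhol.differentiableAt (hD.mem_nhds hz)).hasDerivAt.hasFDerivAt).restrictScalars ℝ
  have hτdd : HasFDerivAt (deriv τ)
      ((ContinuousLinearMap.toSpanSingleton ℂ (deriv (deriv τ) (e' p))).restrictScalars ℝ)
      (e' p) :=
    (((hhol.deriv hD).differentiableAt (hD.mem_nhds hz)).hasDerivAt.hasFDerivAt).restrictScalars ℝ
  set h := g ∘ e.symm with hh
  -- Since the coordinate change τ is holomorphic, its real differential is multiplication by τ', so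
  -- c = τ' and b = τ'' at the point.
  refine ⟨deriv τ (e' p), deriv (deriv τ) (e' p), fun v => ?_⟩
  have hgd : ContDiffOn ℝ ∞ (fderiv ℝ h) e.target :=
    ContDiffOn.fderiv_of_isOpen (m := ∞) hg e.open_target (by simp)
  have h1 : (fun z => fderiv ℝ (g ∘ e'.symm) z v) =ᶠ[nhds (e' p)]
      fun z => fderiv ℝ h (τ z) (v * deriv τ z) := by
    refine Filter.eventually_of_mem (hD.mem_nhds hz) fun z hz => ?_
    have h3 : DifferentiableAt ℝ h (τ z) :=
      (ContDiffOn.contDiffAt hg (e.open_target.mem_nhds (hmaps z hz))).differentiableAt (by simp)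
    have := (h3.hasFDerivAt.comp z (hτd z hz)).fderiv
    change fderiv ℝ (g ∘ e'.symm) z v = _
    rw [(comp_coordChange_eventuallyEq g hz).fderiv_eq, this]
    simp
  have hA : DifferentiableAt ℝ (fderiv ℝ h) (τ (e' p)) :=
    (hgd.contDiffAt (e.open_target.mem_nhds (hmaps _ hz))).differentiableAt (by simp)
  have hB := hA.hasFDerivAt.comp (e' p) (hτd _ hz)
  have hC : HasFDerivAt (fun z => v * deriv τ z) _ (e' p) := hτdd.const_mul v
  have hE := (hB.clm_apply hC).fderiv
  have h5 : cderiv e' v (cderiv e' v g) p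
      = fderiv ℝ (fun z => fderiv ℝ (g ∘ e'.symm) z v) (e' p) v := by
    change fderiv ℝ (cderiv e' v g ∘ e'.symm) (e' p) v = _
    have h3 : cderiv e' v g ∘ e'.symm =ᶠ[nhds (e' p)] fun z => fderiv ℝ (g ∘ e'.symm) z v := by
      refine Filter.eventually_of_mem (e'.open_target.mem_nhds (e'.map_source hp')) fun z hz => ?_
      simp [CGC.cderiv, e'.right_inv hz]
    rw [h3.fderiv_eq]
  rw [h5, h1.fderiv_eq, cderiv_cderiv hg hp]
  refine (congrArg (fun T => T v) hE).trans ?_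
  simp [h2, CGC.cderiv, hh, mul_assoc, add_comm]

/-- Conformal covariance in dimension two, with factor r = |τ'|². The second derivatives of the
coordinate change contribute first-order terms in the directions b and i·i·b, which cancel. -/
theorem laplacian_coordChange {e e' : OpenPartialHomeomorph M ℂ}
    {g : M → Fin 3 → ℝ} (hg : SmoothIn e g) {p : M} (hp : p ∈ e.source)
    (hp' : p ∈ e'.source)
    (hhol : DifferentiableOn ℂ (coordChange e e') (coordDomain e e')) :
    ∃ r : ℝ, laplacian e' g p = r • laplacian e g p := by
  obtain ⟨c, b, h⟩ := cderiv_cderiv_coordChange hg hp hp' hhol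
  refine ⟨Complex.normSq c, ?_⟩
  have hs := cderiv_comm hg hp 1 Complex.I
  have key : ∀ w : ℂ, cderiv e w (cderiv e w g) p = (w.re * w.re) • cderiv e 1 (cderiv e 1 g) p
      + (2 * (w.re * w.im)) • cderiv e 1 (cderiv e Complex.I g) p
      + (w.im * w.im) • cderiv e Complex.I (cderiv e Complex.I g) p := by
    intro w
    rw [cderiv_cderiv hg hp, cderiv_cderiv hg hp, cderiv_cderiv hg hp, cderiv_cderiv hg hp] at *
    have hw : w = w.re • (1 : ℂ) + w.im • Complex.I := by simp
    rw [hw]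
    simp only [map_add, map_smul, _root_.add_apply, _root_.smul_apply, hs]
    simp
    module
  unfold laplacian
  rw [h 1, h Complex.I, key (1 * c), key (Complex.I * c), cderiv_dir (1 * 1 * b),
    cderiv_dir (Complex.I * Complex.I * b)]
  simp [Complex.normSq_apply]
  module

end Calculus

/-! ### Matrix-valued functions -/

section MatrixCalculus

variable {M : Type*} [TopologicalSpace M] {e : OpenPartialHomeomorph M ℂ}

/-- `A` has entries that are smooth on the domain of `e`. -/
def MatSmoothIn (e : OpenPartialHomeomorph M ℂ) (A : M → Mat2) : Prop :=
  ∀ i j, SmoothIn e fun q => A q i j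

theorem MatSmoothIn.mul {A B : M → Mat2} (hA : MatSmoothIn e A) (hB : MatSmoothIn e B) :
    MatSmoothIn e fun q => A q * B q := by
  intro i j
  simp only [Matrix.mul_apply, Fin.sum_univ_two]
  exact ((hA i 0).mul (hB 0 j)).add ((hA i 1).mul (hB 1 j))

theorem MatSmoothIn.const (A : Mat2) : MatSmoothIn e fun _ => A := fun _ _ => SmoothIn.const _

theorem MatSmoothIn.smul {A : M → Mat2} (hA : MatSmoothIn e A) (c : ℂ) :
    MatSmoothIn e fun q => c • A q := fun i j => (SmoothIn.const c).mul (hA i j)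

theorem MatSmoothIn.conjTranspose {A : M → Mat2} (hA : MatSmoothIn e A) :
    MatSmoothIn e fun q => (A q)ᴴ := fun i j => (hA j i).conj

theorem MatSmoothIn.mderiv {A : M → Mat2} (hA : MatSmoothIn e A) (v : ℂ) :
    MatSmoothIn e (mderiv e v A) := fun i j => (hA i j).cderiv v

theorem MatSmoothIn.congr {A B : M → Mat2} (hA : MatSmoothIn e A)
    (h : ∀ q ∈ e.source, B q = A q) : MatSmoothIn e B := fun i j =>
  (hA i j).congr fun q hq => by rw [h q hq]

theorem MatSmoothIn.inv {A : M → Mat2} (hA : MatSmoothIn e A)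
    (h : ∀ q ∈ e.source, (A q).det = 1) : MatSmoothIn e fun q => (A q)⁻¹ := by
  have h1 : MatSmoothIn e fun q => !![A q 1 1, (-1) * A q 0 1; (-1) * A q 1 0, A q 0 0] := by
    intro i j
    fin_cases i <;> fin_cases j
    · exact hA 1 1
    · exact (SmoothIn.const _).mul (hA 0 1)
    · exact (SmoothIn.const _).mul (hA 1 0)
    · exact hA 0 0
  refine h1.congr fun q hq => ?_
  rw [Matrix.inv_def, h q hq, Matrix.adjugate_fin_two]
  simp

theorem mderiv_mul {A B : M → Mat2} (hA : MatSmoothIn e A) (hB : MatSmoothIn e B) {p : M}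
    (hp : p ∈ e.source) (v : ℂ) :
    mderiv e v (fun q => A q * B q) p = mderiv e v A p * B p + A p * mderiv e v B p := by
  ext i j
  simp only [mderiv, Matrix.mul_apply, Fin.sum_univ_two, Matrix.of_apply, Matrix.add_apply]
  rw [cderiv_add ((hA i 0).mul (hB 0 j)) ((hA i 1).mul (hB 1 j)) hp,
    cderiv_mul (hA i 0) (hB 0 j) hp, cderiv_mul (hA i 1) (hB 1 j) hp]
  ring

theorem mderiv_const (A : Mat2) (v : ℂ) (p : M) : mderiv e v (fun _ => A) p = 0 := by
  ext i j; simp [mderiv, cderiv_const]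

theorem mderiv_smul {A : M → Mat2} (hA : MatSmoothIn e A) (c : ℂ) {p : M}
    (hp : p ∈ e.source) (v : ℂ) :
    mderiv e v (fun q => c • A q) p = c • mderiv e v A p := by
  ext i j
  simp only [mderiv, Matrix.smul_apply, smul_eq_mul, Matrix.of_apply]
  rw [cderiv_mul (SmoothIn.const c) (hA i j) hp, cderiv_const]
  simp

theorem mderiv_conjTranspose (A : M → Mat2) (v : ℂ) (p : M) :
    mderiv e v (fun q => (A q)ᴴ) p = (mderiv e v A p)ᴴ := by
  ext i j
  simp only [mderiv, Matrix.conjTranspose_apply, Matrix.of_apply]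
  exact cderiv_conj _ _ _

theorem mderiv_congr {A B : M → Mat2} {p : M} (hp : p ∈ e.source)
    (h : ∀ᶠ q in nhds p, A q = B q) (v : ℂ) : mderiv e v A p = mderiv e v B p := by
  ext i j
  exact cderiv_congr hp (h.mono fun q hq => by rw [hq]) v

theorem mderiv_congr_on {A B : M → Mat2} {p : M} (hp : p ∈ e.source)
    (h : ∀ q ∈ e.source, A q = B q) (v : ℂ) : mderiv e v A p = mderiv e v B p :=
  mderiv_congr hp (Filter.eventually_of_mem (e.open_source.mem_nhds hp) h) v

theorem mderiv_comm {A : M → Mat2} (hA : MatSmoothIn e A) {p : M} (hp : p ∈ e.source) (v w : ℂ) :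
    mderiv e v (mderiv e w A) p = mderiv e w (mderiv e v A) p := by
  ext i j
  exact cderiv_comm (hA i j) hp v w

theorem mderiv_dir (v : ℂ) (A : M → Mat2) (p : M) :
    mderiv e v A p = v.re • mderiv e 1 A p + v.im • mderiv e Complex.I A p := by
  ext i j
  simpa [mderiv] using cderiv_dir (e := e) v (fun q => A q i j) p

theorem mderiv_eq_mdz_mdzbar (v : ℂ) (A : M → Mat2) (p : M) :
    mderiv e v A p = v • mdz e A p + (starRingEnd ℂ v) • mdzbar e A p := by
  ext i j
  have h := cderiv_dir (e := e) v (fun q => A q i j) p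
  simp only [mderiv, mdz, mdzbar, dz, dzbar, Matrix.of_apply, Matrix.add_apply, Matrix.smul_apply,
    smul_eq_mul]
  rw [h]
  have h1 : v + starRingEnd ℂ v = 2 * v.re := by rw [Complex.add_conj]; push_cast; ring
  have h2 : v - starRingEnd ℂ v = 2 * v.im * Complex.I := by rw [Complex.sub_conj]; push_cast; ring
  simp only [Complex.real_smul]
  linear_combination (-(1 / 2) * cderiv e 1 (fun q => A q i j) p) * h1
    + (1 / 2) * Complex.I * cderiv e Complex.I (fun q => A q i j) p * h2
    + v.im * cderiv e Complex.I (fun q => A q i j) p * Complex.I_mul_I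

/-- The chain rule for a change of coordinate. -/
theorem mderiv_coordChange [ChartedSpace ℂ M] {e e' : OpenPartialHomeomorph M ℂ}
    (he : e ∈ IsManifold.maximalAtlas 𝓘(ℝ, ℂ) ∞ M)
    (he' : e' ∈ IsManifold.maximalAtlas 𝓘(ℝ, ℂ) ∞ M) {A : M → Mat2} (hA : MatSmoothIn e A) {p : M}
    (hp : p ∈ e.source) (hp' : p ∈ e'.source) (v : ℂ) :
    mderiv e' v A p = mderiv e (fderiv ℝ (coordChange e e') (e' p) v) A p := by
  ext i j
  exact cderiv_coordChange he he' (hA i j) hp hp' v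

end MatrixCalculus

/-! ### The connection form with spectral parameter -/

section LaxFrame

variable {M : Type*} [TopologicalSpace M] {e : OpenPartialHomeomorph M ℂ}

/-- The value on the direction `v` of the connection form `U dz + V dz̄` where
`U = [[d, λ⁻¹ α], [λ⁻¹ β, -d]]` and `V = [[-d̄, λ τ β̄], [λ τ ᾱ, d̄]]`. -/
def connForm (τ : ℝ) (d α β lam v : ℂ) : Mat2 :=
  !![v * d - starRingEnd ℂ v * starRingEnd ℂ d,
      v * lam⁻¹ * α + starRingEnd ℂ v * lam * τ * starRingEnd ℂ β;
     v * lam⁻¹ * β + starRingEnd ℂ v * lam * τ * starRingEnd ℂ α,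
      -(v * d - starRingEnd ℂ v * starRingEnd ℂ d)]

/-- `Ψ` is a smooth `SL₂ℂ`-valued solution on the domain of `e` of the linear system with
connection form `connForm τ d α β λ`. -/
structure IsLaxFrame (e : OpenPartialHomeomorph M ℂ) (τ : ℝ) (d α β : M → ℂ) (lam : ℂ)
    (Ψ : M → Mat2) : Prop where
  smooth : MatSmoothIn e Ψ
  det_eq_one : ∀ p ∈ e.source, (Ψ p).det = 1
  lax : ∀ p ∈ e.source, ∀ v, mderiv e v Ψ p = Ψ p * connForm τ (d p) (α p) (β p) lam v

variable {τ : ℝ} {d α β : M → ℂ} {lam : ℂ} {Ψ : M → Mat2}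

theorem IsLaxFrame.inv_mul (h : IsLaxFrame e τ d α β lam Ψ) {p : M} (hp : p ∈ e.source) :
    (Ψ p)⁻¹ * Ψ p = 1 := Matrix.nonsing_inv_mul _ (by rw [h.det_eq_one p hp]; exact isUnit_one)

theorem IsLaxFrame.mul_inv (h : IsLaxFrame e τ d α β lam Ψ) {p : M} (hp : p ∈ e.source) :
    Ψ p * (Ψ p)⁻¹ = 1 := Matrix.mul_nonsing_inv _ (by rw [h.det_eq_one p hp]; exact isUnit_one)

theorem IsLaxFrame.mul_left_cancel (h : IsLaxFrame e τ d α β lam Ψ) {p : M} (hp : p ∈ e.source)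
    {A B : Mat2} (hAB : Ψ p * A = Ψ p * B) : A = B := by
  have := congrArg (fun X => (Ψ p)⁻¹ * X) hAB
  simpa [← Matrix.mul_assoc, h.inv_mul hp] using this

theorem IsLaxFrame.mul_right_cancel (h : IsLaxFrame e τ d α β lam Ψ) {p : M} (hp : p ∈ e.source)
    {A B : Mat2} (hAB : A * Ψ p = B * Ψ p) : A = B := by
  have := congrArg (fun X => X * (Ψ p)⁻¹) hAB
  simpa [Matrix.mul_assoc, h.mul_inv hp] using this

theorem IsLaxFrame.const_mul (h : IsLaxFrame e τ d α β lam Ψ) {g : Mat2} (hg : g.det = 1) :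
    IsLaxFrame e τ d α β lam fun q => g * Ψ q where
  smooth := (MatSmoothIn.const g).mul h.smooth
  det_eq_one p hp := by rw [Matrix.det_mul, hg, h.det_eq_one p hp, one_mul]
  lax p hp v := by
    rw [mderiv_mul (MatSmoothIn.const g) h.smooth hp, mderiv_const, h.lax p hp, zero_mul, zero_add,
      Matrix.mul_assoc]

/-- The form is Ψ⁻¹dΨ, so its smoothness is inherited from the frame; nothing has to be shown about
u or the coefficient p. -/
theorem IsLaxFrame.smooth_connForm (h : IsLaxFrame e τ d α β lam Ψ) (v : ℂ) :
    MatSmoothIn e fun q => connForm τ (d q) (α q) (β q) lam v := by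
  refine ((h.smooth.inv h.det_eq_one).mul (h.smooth.mderiv v)).congr fun q hq => ?_
  rw [h.lax q hq, ← Matrix.mul_assoc, h.inv_mul hq, one_mul]

/-- The combination (W(1) - iW(i))/2 extracts the dz-part of the form, whose entries at λ = 1 are d,
α, β. -/
theorem IsLaxFrame.smooth_coeff (h : IsLaxFrame e τ d α β 1 Ψ) :
    SmoothIn e d ∧ SmoothIn e α ∧ SmoothIn e β := by
  have key : ∀ i j, SmoothIn e fun q => (1 / 2 : ℂ) * (connForm τ (d q) (α q) (β q) 1 1 i j
      + (-Complex.I) * connForm τ (d q) (α q) (β q) 1 Complex.I i j) := fun i j =>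
    (SmoothIn.const _).mul ((h.smooth_connForm 1 i j).add
      ((SmoothIn.const _).mul (h.smooth_connForm Complex.I i j)))
  refine ⟨(key 0 0).congr fun q _ => ?_, (key 0 1).congr fun q _ => ?_,
    (key 1 0).congr fun q _ => ?_⟩
  · simp [connForm]
    linear_combination ((1 / 2) * d q + (1 / 2) * starRingEnd ℂ (d q)) * Complex.I_mul_I
  · simp [connForm]
    linear_combination ((1 / 2) * α q - (1 / 2) * τ * starRingEnd ℂ (β q)) * Complex.I_mul_I
  · simp [connForm]
    linear_combination ((1 / 2) * β q - (1 / 2) * τ * starRingEnd ℂ (α q)) * Complex.I_mul_I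

/-- The zero curvature equation. -/
theorem IsLaxFrame.flat (h : IsLaxFrame e τ d α β lam Ψ) {p : M} (hp : p ∈ e.source) (v w : ℂ) :
    connForm τ (d p) (α p) (β p) lam v * connForm τ (d p) (α p) (β p) lam w
        + mderiv e v (fun q => connForm τ (d q) (α q) (β q) lam w) p
      = connForm τ (d p) (α p) (β p) lam w * connForm τ (d p) (α p) (β p) lam v
        + mderiv e w (fun q => connForm τ (d q) (α q) (β q) lam v) p := by
  have key : ∀ v w, mderiv e v (mderiv e w Ψ) p
      = Ψ p * (connForm τ (d p) (α p) (β p) lam v * connForm τ (d p) (α p) (β p) lam w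
        + mderiv e v (fun q => connForm τ (d q) (α q) (β q) lam w) p) := by
    intro v w
    rw [mderiv_congr_on hp (fun q hq => h.lax q hq w), mderiv_mul h.smooth (h.smooth_connForm w) hp,
      h.lax p hp, mul_add, Matrix.mul_assoc]
  exact h.mul_left_cancel hp (by rw [← key, ← key, mderiv_comm h.smooth hp])

theorem mderiv_connForm (hd : SmoothIn e d) (hα : SmoothIn e α) (hβ : SmoothIn e β) {p : M}
    (hp : p ∈ e.source) (lam v w : ℂ) :
    mderiv e v (fun q => connForm τ (d q) (α q) (β q) lam w) p
      = connForm τ (cderiv e v d p) (cderiv e v α p) (cderiv e v β p) lam w := by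
  have key : ∀ (a b : ℂ) {x y : M → ℂ}, SmoothIn e x → SmoothIn e y →
      cderiv e v (fun q => a * x q + b * starRingEnd ℂ (y q)) p
        = a * cderiv e v x p + b * starRingEnd ℂ (cderiv e v y p) := by
    intro a b x y hx hy
    rw [cderiv_add ((SmoothIn.const a).mul hx) ((SmoothIn.const b).mul hy.conj) hp,
      cderiv_mul (SmoothIn.const a) hx hp, cderiv_mul (SmoothIn.const b) hy.conj hp, cderiv_const,
      cderiv_const, cderiv_conj]
    ring
  ext i j
  fin_cases i <;> fin_cases j
  · have := key w (-starRingEnd ℂ w) hd hd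
    change cderiv e v (fun q => w * d q - starRingEnd ℂ w * starRingEnd ℂ (d q)) p =
      w * cderiv e v d p - starRingEnd ℂ w * starRingEnd ℂ (cderiv e v d p)
    rw [show (fun q => w * d q - starRingEnd ℂ w * starRingEnd ℂ (d q))
      = fun q => w * d q + (-starRingEnd ℂ w) * starRingEnd ℂ (d q) from by funext q; ring, this]
    ring
  · exact key (w * lam⁻¹) (starRingEnd ℂ w * lam * τ) hα hβ
  · exact key (w * lam⁻¹) (starRingEnd ℂ w * lam * τ) hβ hα
  · have := key (-w) (starRingEnd ℂ w) hd hd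
    change cderiv e v (fun q => -(w * d q - starRingEnd ℂ w * starRingEnd ℂ (d q))) p =
      -(w * cderiv e v d p - starRingEnd ℂ w * starRingEnd ℂ (cderiv e v d p))
    rw [show (fun q => -(w * d q - starRingEnd ℂ w * starRingEnd ℂ (d q)))
      = fun q => (-w) * d q + (starRingEnd ℂ w) * starRingEnd ℂ (d q) from by funext q; ring, this]
    ring

/-- If the linear system is solvable for two values of the spectral parameter with different
squares, the coefficients of its off-diagonal part are holomorphic sections. -/
theorem IsLaxFrame.holomorphic {Ψ' : M → Mat2} (h : IsLaxFrame e τ d α β 1 Ψ)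
    (h' : IsLaxFrame e τ d α β 2 Ψ') {p : M} (hp : p ∈ e.source) :
    cderiv e 1 α p + Complex.I * cderiv e Complex.I α p = 4 * starRingEnd ℂ (d p) * α p ∧
    cderiv e 1 β p + Complex.I * cderiv e Complex.I β p = -4 * starRingEnd ℂ (d p) * β p := by
  obtain ⟨hd, hα, hβ⟩ := h.smooth_coeff
  have h1 := h.flat hp 1 Complex.I
  have h2 := h'.flat hp 1 Complex.I
  rw [mderiv_connForm hd hα hβ hp, mderiv_connForm hd hα hβ hp] at h1 h2
  have a1 := congrFun (congrFun h1 0) 1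
  have a2 := congrFun (congrFun h2 0) 1
  have b1 := congrFun (congrFun h1 1) 0
  have b2 := congrFun (congrFun h2 1) 0
  simp [connForm] at a1 a2 b1 b2
  have hI := Complex.I_mul_I
  constructor
  -- Off the diagonal the zero curvature equation has the shape λ⁻¹X + λY = 0. The weights 4/3 at λ
  -- = 1 and -2/3 at λ = 2 eliminate Y and leave X.
  · linear_combination (-Complex.I) * ((4 / 3) * a1 - (2 / 3) * a2)
      + (cderiv e 1 α p - 4 * starRingEnd ℂ (d p) * α p) * hI
  · linear_combination (-Complex.I) * ((4 / 3) * b1 - (2 / 3) * b2)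
      + (cderiv e 1 β p + 4 * starRingEnd ℂ (d p) * β p) * hI

end LaxFrame

/-! ### The Hermitian form of signature `(2, 0)` or `(1, 1)` -/

theorem mul_entry (A B : Mat2) (i j : Fin 2) : (A * B) i j = A i 0 * B 0 j + A i 1 * B 1 j := by
  rw [Matrix.mul_apply, Fin.sum_univ_two]

/-- The Hermitian form `diag(1, s)`. -/
def hermForm (s : ℝ) : Mat2 := !![1, 0; 0, (s : ℂ)]

theorem isHermitian_hermForm (s : ℝ) : (hermForm s)ᴴ = hermForm s := by
  ext i j; fin_cases i <;> fin_cases j <;> simp [hermForm]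

theorem e1_mul_hermForm (s : ℝ) : e1 * hermForm s = hermForm s * e1 := by
  ext i j; fin_cases i <;> fin_cases j <;> simp [hermForm, e1]

theorem isHermitian_e1 : e1ᴴ = e1 := by
  ext i j; fin_cases i <;> fin_cases j <;> simp [e1]

/-! ### Coordinates on 𝔰𝔲₂ and 𝔰𝔲₁,₁, and the adjoint orbit of i e₁. -/

/-- The coordinates of a trace-free matrix that is skew-adjoint for `hermForm s`. -/
def lieCoord (A : Mat2) : Fin 3 → ℝ := ![(A 0 0).im, (A 0 1).re, (A 0 1).im]

theorem lieCoord_toLieAlg (s : ℝ) (x : Fin 3 → ℝ) : lieCoord (toLieAlg s x) = x := by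
  ext i; fin_cases i <;> simp [lieCoord, toLieAlg]

theorem toLieAlg_injective (s : ℝ) : Function.Injective (toLieAlg s) :=
  Function.LeftInverse.injective (lieCoord_toLieAlg s)

theorem toLieAlg_add (s : ℝ) (x y : Fin 3 → ℝ) :
    toLieAlg s (x + y) = toLieAlg s x + toLieAlg s y := by
  ext i j; fin_cases i <;> fin_cases j <;> simp [toLieAlg] <;> ring

theorem toLieAlg_smul (s r : ℝ) (x : Fin 3 → ℝ) :
    toLieAlg s (r • x) = (r : ℂ) • toLieAlg s x := by
  ext i j; fin_cases i <;> fin_cases j <;> simp [toLieAlg] <;> ring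

theorem toLieAlg_lieCoord {s : ℝ} {A : Mat2} (h : A * hermForm s + hermForm s * Aᴴ = 0)
    (ht : A.trace = 0) : toLieAlg s (lieCoord A) = A := by
  have h00 := congrFun (congrFun h 0) 0
  have h10 := congrFun (congrFun h 1) 0
  simp only [Matrix.add_apply, mul_entry] at h00 h10
  simp [hermForm] at h00 h10
  rw [Matrix.trace_fin_two] at ht
  have h0 : Complex.I * (A 0 0).im = A 0 0 := by
    have hr : (A 0 0).re = 0 := by
      have := congrArg Complex.re h00
      simp at this; linarith
    apply Complex.ext <;> simp [hr]
  have h1 : ((A 0 1).re : ℂ) + Complex.I * (A 0 1).im = A 0 1 := by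
    apply Complex.ext <;> simp
  have h2 : ((A 0 1).re : ℂ) - Complex.I * (A 0 1).im = starRingEnd ℂ (A 0 1) := by
    apply Complex.ext <;> simp
  ext i j
  fin_cases i <;> fin_cases j
  · simpa [toLieAlg, lieCoord] using h0
  · simpa [toLieAlg, lieCoord] using h1
  · simp [toLieAlg, lieCoord, h2]
    linear_combination -h10
  · simp [toLieAlg, lieCoord, h0]
    linear_combination -ht

theorem det_toLieAlg {s : ℝ} (hs : s * s = 1) (x : Fin 3 → ℝ) :
    (toLieAlg s x).det = ((s * form s x x : ℝ) : ℂ) := by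
  have hs' : (s : ℂ) * s = 1 := by exact_mod_cast hs
  simp [toLieAlg, Matrix.det_fin_two, form]
  linear_combination (-(x 0 : ℂ) ^ 2 - s * (x 2 : ℂ) ^ 2) * Complex.I_mul_I - (x 0 : ℂ) ^ 2 * hs'

theorem trace_toLieAlg_mul (s : ℝ) (hs : s * s = 1) (x y : Fin 3 → ℝ) :
    (toLieAlg s x * toLieAlg s y).trace = ((-2 * s * form s x y : ℝ) : ℂ) := by
  have hs' : (s : ℂ) * s = 1 := by exact_mod_cast hs
  simp [toLieAlg, Matrix.trace_fin_two, form]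
  linear_combination (2 * (x 0 : ℂ) * y 0 + 2 * s * (x 2 : ℂ) * y 2) * Complex.I_mul_I
    + 2 * (x 0 : ℂ) * y 0 * hs'

/-- Substituting E = ΘEΘ* gives AE = iΘ(e₁E)Θ*, and e₁E is Hermitian because e₁ and E commute. Hence
AE is skew-Hermitian, while trace and determinant are invariant under conjugation. -/
theorem unitary_gauss {s : ℝ} {Θ : Mat2} (hdet : Θ.det = 1)
    (hΘ : Θ * hermForm s * Θᴴ = hermForm s) :
    let A := Complex.I • (Θ * e1 * Θ⁻¹)
    A * hermForm s + hermForm s * Aᴴ = 0 ∧ A.trace = 0 ∧ A.det = 1 ∧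
      A * hermForm s = Complex.I • (Θ * (e1 * hermForm s) * Θᴴ) := by
  intro A
  have hu : IsUnit Θ.det := by rw [hdet]; exact isUnit_one
  have hi : Θ⁻¹ * Θ = 1 := Matrix.nonsing_inv_mul _ hu
  have hA : A * hermForm s = Complex.I • (Θ * (e1 * hermForm s) * Θᴴ) := by
    rw [← hΘ]
    simp only [A, Matrix.smul_mul]
    congr 1
    calc Θ * e1 * Θ⁻¹ * (Θ * hermForm s * Θᴴ) = Θ * e1 * (Θ⁻¹ * Θ) * hermForm s * Θᴴ := by
          simp only [Matrix.mul_assoc]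
      _ = _ := by rw [hi, hΘ]; simp only [Matrix.mul_assoc, Matrix.one_mul]
  refine ⟨?_, ?_, ?_, hA⟩
  · have : hermForm s * Aᴴ = (A * hermForm s)ᴴ := by
      rw [Matrix.conjTranspose_mul, isHermitian_hermForm]
    rw [this, hA]
    simp only [Matrix.conjTranspose_smul, Matrix.conjTranspose_mul,
      Matrix.conjTranspose_conjTranspose, isHermitian_hermForm, isHermitian_e1, e1_mul_hermForm]
    simp [Matrix.mul_assoc]
  · simp only [A, Matrix.trace_smul]
    rw [Matrix.trace_mul_comm, ← Matrix.mul_assoc, hi, Matrix.one_mul]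
    simp [e1, Matrix.trace_fin_two]
  · have h1 : (Θ * e1 * Θ⁻¹).det = -1 := by
      have : Θ.det * (Θ⁻¹).det = 1 := by
        rw [← Matrix.det_mul, Matrix.mul_nonsing_inv _ hu, Matrix.det_one]
      rw [Matrix.det_mul, Matrix.det_mul]
      simp only [e1, Matrix.det_fin_two_of]
      linear_combination -this
    simp [A, h1]

/-- For s = -1 the matrix e₁E is the identity, so AE = iΘΘ* and the coordinate is the squared norm
of the first row of Θ. This selects the upper sheet. -/
theorem hyperbolic_gauss_pos {Θ : Mat2} (hdet : Θ.det = 1)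
    (hΘ : Θ * hermForm (-1) * Θᴴ = hermForm (-1)) :
    0 < lieCoord (Complex.I • (Θ * e1 * Θ⁻¹)) 0 := by
  obtain ⟨-, -, -, h⟩ := unitary_gauss hdet hΘ
  have h00 := congrFun (congrFun h 0) 0
  set A := Complex.I • (Θ * e1 * Θ⁻¹)
  simp only [Matrix.smul_apply, mul_entry] at h00
  have hz : Θ 0 0 ≠ 0 ∨ Θ 0 1 ≠ 0 := by
    by_contra hc
    push Not at hc
    rw [Matrix.det_fin_two, hc.1, hc.2] at hdet
    simp at hdet
  have h1 : (A 0 0).im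
      = Complex.normSq (Θ 0 0) + Complex.normSq (Θ 0 1) := by
    have := congrArg Complex.im h00
    simpa [hermForm, e1, Complex.mul_conj] using this
  change 0 < (A 0 0).im
  rw [h1]
  have n0 := Complex.normSq_nonneg (Θ 0 0)
  have n1 := Complex.normSq_nonneg (Θ 0 1)
  rcases hz with hz | hz
  · have := Complex.normSq_pos.2 hz; linarith
  · have := Complex.normSq_pos.2 hz; linarith

/-! ### The reality condition on the spectral parameter and its consequences. -/

/-- The condition reads λ̄τ = -sλ⁻¹ and λτ = -sλ̄⁻¹: it turns the coefficient of dz̄ in one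
off-diagonal entry into -s times the conjugate of the dz-coefficient in the other. -/
theorem connForm_skew {τ s : ℝ} {lam : ℂ} (hs : s * s = 1) (hl : ‖lam‖ ^ 2 * τ = -s)
    (d α β v : ℂ) : connForm τ d α β lam v * hermForm s
      + hermForm s * (connForm τ d α β lam v)ᴴ = 0 := by
  have hs' : (s : ℂ) * s = 1 := by exact_mod_cast hs
  have hl' : lam * starRingEnd ℂ lam * τ = -s := by
    rw [Complex.mul_conj, Complex.normSq_eq_norm_sq]; exact_mod_cast hl
  have hlam : lam ≠ 0 := by
    rintro rfl
    simp at hl'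
    rw [hl'] at hs'; simp at hs'
  have hlam' : starRingEnd ℂ lam ≠ 0 := by simpa using hlam
  have k1 : starRingEnd ℂ lam * τ = -s * lam⁻¹ := by field_simp; linear_combination hl'
  have k2 : lam * τ = -s * (starRingEnd ℂ lam)⁻¹ := by field_simp; linear_combination hl'
  ext i j
  fin_cases i <;> fin_cases j
  · simp only [Matrix.add_apply, mul_entry]
    simp [connForm, hermForm]
  · simp only [Matrix.add_apply, mul_entry]
    simp [connForm, hermForm]
    linear_combination v * α * k1 + s * starRingEnd ℂ v * starRingEnd ℂ β * k2
      - starRingEnd ℂ v * starRingEnd ℂ β * (starRingEnd ℂ lam)⁻¹ * hs'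
  · simp only [Matrix.add_apply, mul_entry]
    simp [connForm, hermForm]
    linear_combination starRingEnd ℂ v * starRingEnd ℂ α * k2 + s * v * β * k1
      - v * β * lam⁻¹ * hs'
  · simp only [Matrix.add_apply, mul_entry]
    simp [connForm, hermForm]
    ring

theorem connForm_offDiag {τ s : ℝ} {lam : ℂ} (hs : s * s = 1) (hl : ‖lam‖ ^ 2 * τ = -s)
    (d α β v : ℂ) : connForm τ d α β lam v 1 0
      = -s * starRingEnd ℂ (connForm τ d α β lam v 0 1) := by
  have h := congrFun (congrFun (connForm_skew hs hl d α β v) 1) 0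
  rw [Matrix.add_apply, mul_entry, mul_entry, Matrix.zero_apply] at h
  simp only [hermForm, Matrix.of_apply, Matrix.cons_val_zero, Matrix.cons_val_one,
    Matrix.conjTranspose_apply, Matrix.cons_val', RCLike.star_def] at h
  simp only [mul_one, mul_zero, add_zero, zero_mul, zero_add] at h
  linear_combination h

/-- The two summands of the upper entry have moduli |v||λ|⁻¹|α| and |v||λ||τ||β|. As |λ|²|τ| = 1,
they can cancel for v ≠ 0 only if |α| = |β|. -/
theorem connForm_nondegenerate {τ s : ℝ} {lam : ℂ} (hs : s * s = 1) (hl : ‖lam‖ ^ 2 * τ = -s)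
    {d α β v : ℂ} (hαβ : ‖α‖ ≠ ‖β‖) (hv : connForm τ d α β lam v 0 1 = 0) : v = 0 := by
  have hs0 : s ≠ 0 := by rintro rfl; simp at hs
  have hl0 : ‖lam‖ ≠ 0 := by
    intro h; rw [h] at hl; apply hs0; linarith
  by_contra hv0
  have hv1 : ‖v‖ ≠ 0 := by simpa using hv0
  apply hαβ
  simp only [connForm, Matrix.of_apply, Matrix.cons_val_zero, Matrix.cons_val_one,
    Matrix.cons_val'] at hv
  have h1 := congrArg norm (eq_neg_of_add_eq_zero_left hv)
  rw [norm_neg] at h1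
  simp only [norm_mul, norm_inv, RCLike.norm_conj, Complex.norm_real, Real.norm_eq_abs] at h1
  have h2 : ‖lam‖ ^ 2 * |τ| = 1 := by
    have h3 : |‖lam‖ ^ 2 * τ| = |s| := by rw [hl, abs_neg]
    rw [abs_mul, abs_of_nonneg (by positivity)] at h3
    rw [h3]
    have : |s| * |s| = 1 := by rw [← abs_mul, hs, abs_one]
    nlinarith [abs_nonneg s]
  have h4 : ‖v‖ * (‖α‖ - ‖β‖) = 0 := by
    field_simp at h1
    linear_combination ‖v‖ * h1 + ‖v‖ * ‖β‖ * h2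
  rcases mul_eq_zero.1 h4 with h | h
  · exact absurd h hv1
  · linarith

/-! ### The Gauss map of a frame -/

section Gauss

variable {M : Type*} [TopologicalSpace M] {e : OpenPartialHomeomorph M ℂ}
variable {τ : ℝ} {d α β : M → ℂ} {lam : ℂ} {Ψ L : M → Mat2}

/-- The commutator of a trace-free matrix with `e₁`. -/
def brk (W : Mat2) : Mat2 := !![0, -2 * W 0 1; 2 * W 1 0, 0]

theorem brk_eq (W : Mat2) : W * e1 - e1 * W = brk W := by
  ext i j; fin_cases i <;> fin_cases j <;>
    simp only [Matrix.sub_apply, mul_entry] <;> simp [brk, e1] <;> ring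

/-- Writing LΨ instead of L keeps Ψ⁻¹ out of the derivative computations that follow. -/
theorem gauss_mul (h : IsLaxFrame e τ d α β lam Ψ)
    (hL : ∀ q ∈ e.source, L q = Complex.I • (Ψ q * e1 * (Ψ q)⁻¹)) {q : M} (hq : q ∈ e.source) :
    L q * Ψ q = Complex.I • (Ψ q * e1) := by
  rw [hL q hq, Matrix.smul_mul, Matrix.mul_assoc, h.inv_mul hq, Matrix.mul_one]

theorem smooth_gauss (h : IsLaxFrame e τ d α β lam Ψ)
    (hL : ∀ q ∈ e.source, L q = Complex.I • (Ψ q * e1 * (Ψ q)⁻¹)) : MatSmoothIn e L :=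
  (((h.smooth.mul (MatSmoothIn.const e1)).mul (h.smooth.inv h.det_eq_one)).smul Complex.I).congr hL

theorem mderiv_gauss (h : IsLaxFrame e τ d α β lam Ψ)
    (hL : ∀ q ∈ e.source, L q = Complex.I • (Ψ q * e1 * (Ψ q)⁻¹)) {p : M} (hp : p ∈ e.source)
    (v : ℂ) : mderiv e v L p * Ψ p
      = Complex.I • (Ψ p * brk (connForm τ (d p) (α p) (β p) lam v)) := by
  have h1 := mderiv_congr_on hp (fun q hq => gauss_mul h hL hq) v
  rw [mderiv_mul (smooth_gauss h hL) h.smooth hp,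
    mderiv_smul (h.smooth.mul (MatSmoothIn.const e1)) _ hp,
    mderiv_mul h.smooth (MatSmoothIn.const e1) hp, mderiv_const, h.lax p hp, Matrix.mul_zero,
    add_zero, ← Matrix.mul_assoc, gauss_mul h hL hp] at h1
  rw [eq_sub_of_add_eq h1, ← brk_eq]
  simp only [Matrix.smul_mul, ← smul_sub, mul_sub, Matrix.mul_assoc]

theorem mderiv_brk {W : M → Mat2} (hW : MatSmoothIn e W) {p : M} (hp : p ∈ e.source) (v : ℂ) :
    mderiv e v (fun q => brk (W q)) p = brk (mderiv e v W p) := by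
  ext i j
  fin_cases i <;> fin_cases j
  · exact cderiv_const _ _ _
  · change cderiv e v (fun q => (-2) * W q 0 1) p = _
    rw [cderiv_mul (SmoothIn.const _) (hW 0 1) hp, cderiv_const]
    simp [brk, mderiv]
  · change cderiv e v (fun q => 2 * W q 1 0) p = _
    rw [cderiv_mul (SmoothIn.const _) (hW 1 0) hp, cderiv_const]
    simp [brk, mderiv]
  · exact cderiv_const _ _ _

theorem smooth_brk {W : M → Mat2} (hW : MatSmoothIn e W) : MatSmoothIn e fun q => brk (W q) := by
  intro i j
  fin_cases i <;> fin_cases j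
  · exact SmoothIn.const _
  · exact (SmoothIn.const (-2)).mul (hW 0 1)
  · exact (SmoothIn.const 2).mul (hW 1 0)
  · exact SmoothIn.const _

theorem mderiv_mderiv_gauss (h : IsLaxFrame e τ d α β lam Ψ)
    (hL : ∀ q ∈ e.source, L q = Complex.I • (Ψ q * e1 * (Ψ q)⁻¹)) (hd : SmoothIn e d)
    (hα : SmoothIn e α) (hβ : SmoothIn e β) {p : M} (hp : p ∈ e.source) (v : ℂ) :
    mderiv e v (mderiv e v L) p * Ψ p = Complex.I • (Ψ p *
      (connForm τ (d p) (α p) (β p) lam v * brk (connForm τ (d p) (α p) (β p) lam v)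
        - brk (connForm τ (d p) (α p) (β p) lam v) * connForm τ (d p) (α p) (β p) lam v
        + brk (connForm τ (cderiv e v d p) (cderiv e v α p) (cderiv e v β p) lam v))) := by
  have h1 := mderiv_congr_on hp (fun q hq => mderiv_gauss h hL hq v) v
  have hb := smooth_brk (h.smooth_connForm v)
  rw [mderiv_mul ((smooth_gauss h hL).mderiv v) h.smooth hp,
    mderiv_smul (h.smooth.mul hb) _ hp, mderiv_mul h.smooth hb hp,
    mderiv_brk (h.smooth_connForm v) hp, mderiv_connForm hd hα hβ hp, h.lax p hp,
    ← Matrix.mul_assoc, mderiv_gauss h hL hp] at h1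
  rw [eq_sub_of_add_eq h1]
  simp only [Matrix.smul_mul, ← smul_sub, mul_sub, mul_add, Matrix.mul_assoc]
  congr 1
  abel

/-- The Gauss map is harmonic: its Laplacian is a multiple of itself. -/
theorem laplacian_gauss (h : IsLaxFrame e τ d α β lam Ψ)
    (hL : ∀ q ∈ e.source, L q = Complex.I • (Ψ q * e1 * (Ψ q)⁻¹)) (hd : SmoothIn e d)
    (hα : SmoothIn e α) (hβ : SmoothIn e β) {p : M} (hp : p ∈ e.source)
    (hol : cderiv e 1 α p + Complex.I * cderiv e Complex.I α p = 4 * starRingEnd ℂ (d p) * α p ∧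
      cderiv e 1 β p + Complex.I * cderiv e Complex.I β p = -4 * starRingEnd ℂ (d p) * β p)
    {s : ℝ} (hs : s * s = 1) (hl : ‖lam‖ ^ 2 * τ = -s) :
    ∃ κ : ℝ, mderiv e 1 (mderiv e 1 L) p + mderiv e Complex.I (mderiv e Complex.I L) p
      = (κ : ℂ) • L p := by
  set W := connForm τ (d p) (α p) (β p) lam with hW
  -- The double commutator [W, [W, e₁]] has diagonal part 4W₀₁W₁₀ e₁, and W₁₀ = -s times the
  -- conjugate of W₀₁. Summing over the directions 1 and i gives κ.
  refine ⟨-4 * s * (Complex.normSq (W 1 0 1) + Complex.normSq (W Complex.I 0 1)),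
    h.mul_right_cancel hp ?_⟩
  rw [add_mul, mderiv_mderiv_gauss h hL hd hα hβ hp, mderiv_mderiv_gauss h hL hd hα hβ hp,
    ← smul_add, ← mul_add, Matrix.smul_mul, gauss_mul h hL hp, smul_comm _ Complex.I]
  congr 1
  rw [← Matrix.mul_smul]
  congr 1
  have o1 := connForm_offDiag hs hl (d p) (α p) (β p) 1
  have o2 := connForm_offDiag hs hl (d p) (α p) (β p) Complex.I
  rw [← hW] at o1 o2
  have hI := Complex.I_mul_I
  -- The equations and their conjugates cancel the off-diagonal entries: each such entry of the
  -- Laplacian is the divergence of a dz-part in α or β and a dz̄-part in β̄ or ᾱ, corrected by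
  -- terms in d and d̄.
  obtain ⟨h1, h2⟩ := hol
  have h3 := congrArg (starRingEnd ℂ) h1
  have h4 := congrArg (starRingEnd ℂ) h2
  simp only [map_add, map_mul, map_neg, Complex.conj_I, Complex.conj_conj, map_ofNat] at h3 h4
  have c1 := Complex.mul_conj (W 1 0 1)
  have c2 := Complex.mul_conj (W Complex.I 0 1)
  ext i j
  fin_cases i <;> fin_cases j
  · simp only [Matrix.sub_apply, Matrix.add_apply, Matrix.smul_apply, mul_entry]
    simp [brk, e1]
    linear_combination 4 * W 1 0 1 * o1 + 4 * W Complex.I 0 1 * o2 - 4 * s * c1 - 4 * s * c2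
  · simp only [Matrix.sub_apply, Matrix.add_apply, Matrix.smul_apply, mul_entry]
    simp [brk, e1]
    simp [connForm]
    linear_combination (-2 * lam⁻¹) * h1 - 2 * lam * τ * h4 + (4 * (d p + starRingEnd ℂ (d p)) * (lam * τ * starRingEnd ℂ (β p) - lam⁻¹ * α p)) * hI
  · simp only [Matrix.sub_apply, Matrix.add_apply, Matrix.smul_apply, mul_entry]
    simp [brk, e1]
    simp [connForm]
    linear_combination (2 * lam⁻¹) * h2 + 2 * lam * τ * h3 + (4 * (d p + starRingEnd ℂ (d p)) * (lam * τ * starRingEnd ℂ (α p) - lam⁻¹ * β p)) * hI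
  · simp only [Matrix.sub_apply, Matrix.add_apply, Matrix.smul_apply, mul_entry]
    simp [brk, e1]
    linear_combination -4 * W 1 0 1 * o1 - 4 * W Complex.I 0 1 * o2 + 4 * s * c1 + 4 * s * c2

end Gauss

/-! ### The Hermitian form determined by the Gauss map -/

section Uniqueness

variable {M : Type*} [TopologicalSpace M] {e e' : OpenPartialHomeomorph M ℂ}
variable {τ s : ℝ} {d α β d' α' β' : M → ℂ} {lam : ℂ} {Ψ Ψ' L : M → Mat2}

/-- The derivative of ΨEΨ* is Ψ(WE + EW*)Ψ*, which vanishes by `connForm_skew`. -/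
theorem IsLaxFrame.herm_eventually_eq (h : IsLaxFrame e τ d α β lam Ψ) (hs : s * s = 1)
    (hl : ‖lam‖ ^ 2 * τ = -s) {p : M} (hp : p ∈ e.source) : ∀ᶠ q in nhds p, q ∈ e.source ∧
      Ψ q * hermForm s * (Ψ q)ᴴ = Ψ p * hermForm s * (Ψ p)ᴴ := by
  have h1 := h.smooth.mul (MatSmoothIn.const (e := e) (hermForm s))
  have hsm := h1.mul h.smooth.conjTranspose
  have h0 : ∀ q ∈ e.source, ∀ v,
      mderiv e v (fun q => Ψ q * hermForm s * (Ψ q)ᴴ) q = 0 := by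
    intro q hq v
    rw [mderiv_mul h1 h.smooth.conjTranspose hq, mderiv_mul h.smooth (MatSmoothIn.const _) hq,
      mderiv_const, mderiv_conjTranspose, h.lax q hq, Matrix.conjTranspose_mul, Matrix.mul_zero,
      add_zero]
    have := congrArg (fun X => Ψ q * X * (Ψ q)ᴴ) (connForm_skew hs hl (d q) (α q) (β q) v)
    simpa [Matrix.mul_assoc, mul_add, add_mul] using this
  have key : ∀ i j, ∀ᶠ q in nhds p, q ∈ e.source ∧
      (Ψ q * hermForm s * (Ψ q)ᴴ) i j = (Ψ p * hermForm s * (Ψ p)ᴴ) i j := fun i j =>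
    (hsm i j).eventually_eq (fun q hq v => congrFun (congrFun (h0 q hq v) i) j) hp
  filter_upwards [key 0 0, key 0 1, key 1 0, key 1 1] with q h00 h01 h10 h11
  refine ⟨h00.1, ?_⟩
  ext i j
  fin_cases i <;> fin_cases j
  exacts [h00.2, h01.2, h10.2, h11.2]

/-- L is skew-adjoint for the Hermitian form of any frame that represents it. This is the link
between L and the form that `herm_unique` exploits. -/
theorem gauss_herm (h : IsLaxFrame e τ d α β lam Ψ)
    (hL : ∀ q ∈ e.source, L q = Complex.I • (Ψ q * e1 * (Ψ q)⁻¹)) {q : M} (hq : q ∈ e.source) :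
    L q * (Ψ q * hermForm s * (Ψ q)ᴴ) + (Ψ q * hermForm s * (Ψ q)ᴴ) * (L q)ᴴ = 0 := by
  have h1 := gauss_mul h hL hq
  have h2 : (Ψ q)ᴴ * (L q)ᴴ = -Complex.I • (e1 * (Ψ q)ᴴ) := by
    rw [← Matrix.conjTranspose_mul, h1, Matrix.conjTranspose_smul, Matrix.conjTranspose_mul,
      isHermitian_e1]
    simp
  rw [← Matrix.mul_assoc, ← Matrix.mul_assoc, h1, Matrix.mul_assoc (Ψ q * hermForm s), h2]
  simp only [Matrix.smul_mul, Matrix.mul_smul, neg_smul, Matrix.mul_neg, Matrix.mul_assoc]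
  rw [← Matrix.mul_assoc e1, e1_mul_hermForm, Matrix.mul_assoc, add_neg_cancel]

/-- The Hermitian form preserved by a frame depends only on the Gauss map of the frame. -/
theorem herm_unique
    (h : IsLaxFrame e τ d α β lam Ψ) (h' : IsLaxFrame e' τ d' α' β' lam Ψ')
    (hL : ∀ q ∈ e.source, L q = Complex.I • (Ψ q * e1 * (Ψ q)⁻¹))
    (hL' : ∀ q ∈ e'.source, L q = Complex.I • (Ψ' q * e1 * (Ψ' q)⁻¹))
    (hs : s * s = 1) (hl : ‖lam‖ ^ 2 * τ = -s) {p : M} (hp : p ∈ e.source) (hp' : p ∈ e'.source)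
    (hαβ : ‖α p‖ ≠ ‖β p‖) :
    Ψ p * hermForm s * (Ψ p)ᴴ = Ψ' p * hermForm s * (Ψ' p)ᴴ := by
  have hsL := smooth_gauss h hL
  set H := Ψ' p * hermForm s * (Ψ' p)ᴴ with hH
  have hev : ∀ᶠ q in nhds p, L q * H + H * (L q)ᴴ = 0 := by
    filter_upwards [h'.herm_eventually_eq hs hl hp'] with q hq
    rw [hH, ← hq.2]
    exact gauss_herm h' hL' hq.1
  have hder : mderiv e 1 L p * H + H * (mderiv e 1 L p)ᴴ = 0 := by
    have h1 := mderiv_congr hp (hev.mono fun q hq => eq_neg_of_add_eq_zero_left hq) 1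
    have h2 : (fun q => -(H * (L q)ᴴ)) = fun q => (-H) * (L q)ᴴ := by
      funext q; rw [Matrix.neg_mul]
    rw [h2, mderiv_mul hsL (MatSmoothIn.const H) hp, mderiv_const,
      mderiv_mul (MatSmoothIn.const (-H)) hsL.conjTranspose hp, mderiv_const,
      mderiv_conjTranspose, Matrix.mul_zero, add_zero, Matrix.zero_mul, zero_add,
      Matrix.neg_mul] at h1
    rw [h1, neg_add_cancel]
  set D := (Ψ p)⁻¹ * Ψ' p with hD
  have hΨ' : Ψ' p = Ψ p * D := by rw [hD, ← Matrix.mul_assoc, h.mul_inv hp, Matrix.one_mul]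
  have hdetD : D.det = 1 := by
    have := h'.det_eq_one p hp'
    rwa [hΨ', Matrix.det_mul, h.det_eq_one p hp, one_mul] at this
  -- Both frames produce the same L, so their quotient D stabilizes e₁ and is diagonal. It remains
  -- to see that its entries have modulus one.
  have hcomm : e1 * D = D * e1 := by
    have h1 := gauss_mul h' hL' hp'
    rw [hΨ', ← Matrix.mul_assoc, gauss_mul h hL hp, Matrix.smul_mul] at h1
    have h2 := smul_right_injective Mat2 Complex.I_ne_zero h1
    exact h.mul_left_cancel hp (by simpa only [Matrix.mul_assoc] using h2)
  have h01 := congrFun (congrFun hcomm 0) 1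
  have h10 := congrFun (congrFun hcomm 1) 0
  rw [mul_entry, mul_entry] at h01 h10
  simp [e1] at h01 h10
  have d01 : D 0 1 = 0 := by linear_combination (1 / 2) * h01
  have d10 : D 1 0 = 0 := by linear_combination (-1 / 2) * h10
  rw [Matrix.det_fin_two, d01, d10] at hdetD
  set X := D * hermForm s * Dᴴ with hX
  have hHX : H = Ψ p * X * (Ψ p)ᴴ := by
    rw [hH, hΨ', hX, Matrix.conjTranspose_mul]
    simp only [Matrix.mul_assoc]
  set W := connForm τ (d p) (α p) (β p) lam 1 with hW
  have hbrk : brk W * X = X * (brk W)ᴴ := by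
    have g1 : mderiv e 1 L p * Ψ p = Complex.I • (Ψ p * brk W) := mderiv_gauss h hL hp 1
    have g2 : (Ψ p)ᴴ * (mderiv e 1 L p)ᴴ = -Complex.I • ((brk W)ᴴ * (Ψ p)ᴴ) := by
      rw [← Matrix.conjTranspose_mul, g1, Matrix.conjTranspose_smul, Matrix.conjTranspose_mul]
      simp
    rw [hHX, ← Matrix.mul_assoc, ← Matrix.mul_assoc, g1, Matrix.mul_assoc (Ψ p * X), g2] at hder
    simp only [Matrix.smul_mul, Matrix.mul_smul, neg_smul, Matrix.mul_neg, Matrix.mul_assoc] at hder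
    rw [add_neg_eq_zero] at hder
    have h3 : brk W * X * (Ψ p)ᴴ = X * (brk W)ᴴ * (Ψ p)ᴴ := by
      simpa only [Matrix.mul_assoc] using
        h.mul_left_cancel hp (smul_right_injective Mat2 Complex.I_ne_zero hder)
    have h5 : (Ψ p)ᴴ * (Ψ p)⁻¹ᴴ = 1 := by
      rw [← Matrix.conjTranspose_mul, h.inv_mul hp, Matrix.conjTranspose_one]
    calc brk W * X = brk W * X * (Ψ p)ᴴ * (Ψ p)⁻¹ᴴ := by
          rw [Matrix.mul_assoc (brk W * X), h5, Matrix.mul_one]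
      _ = X * (brk W)ᴴ := by rw [h3, Matrix.mul_assoc (X * _), h5, Matrix.mul_one]
  have hW0 : W 0 1 ≠ 0 := fun hc =>
    one_ne_zero (connForm_nondegenerate hs hl hαβ hc)
  have hW10 := connForm_offDiag hs hl (d p) (α p) (β p) 1
  rw [← hW] at hW10
  have x00 : X 0 0 = D 0 0 * starRingEnd ℂ (D 0 0) := by
    rw [hX, mul_entry, mul_entry, mul_entry]; simp [hermForm, d01]
  have x11 : X 1 1 = s * (D 1 1 * starRingEnd ℂ (D 1 1)) := by
    rw [hX, mul_entry, mul_entry, mul_entry]; simp [hermForm, d10]; ring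
  have x01 : X 0 1 = 0 := by
    rw [hX, mul_entry, mul_entry, mul_entry]; simp [hermForm, d10, d01]
  have x10 : X 1 0 = 0 := by
    rw [hX, mul_entry, mul_entry, mul_entry]; simp [hermForm, d10, d01]
  have hs' : (s : ℂ) * s = 1 := by exact_mod_cast hs
  have hs0 : (s : ℂ) ≠ 0 := by intro hc; rw [hc] at hs'; simp at hs'
  -- Skewness of dL pulls back to a condition on [W, e₁], whose off-diagonal entry is nonzero by |α|
  -- ≠ |β|. It fixes the ratio of the two diagonal entries of X = DED*.
  have hx : X 1 1 = s * X 0 0 := by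
    have h1 := congrFun (congrFun hbrk 0) 1
    rw [mul_entry, mul_entry] at h1
    simp [brk, x01, hW10] at h1
    have h2 : W 0 1 * (X 1 1 - s * X 0 0) = 0 := by linear_combination (1 / 2) * h1
    rcases mul_eq_zero.1 h2 with h2 | h2
    · exact absurd h2 hW0
    · linear_combination h2
  -- The ratio gives |D₀₀| = |D₁₁|, and det D = 1 gives |D₀₀||D₁₁| = 1.
  have hnorm : Complex.normSq (D 0 0) = 1 := by
    rw [x00, x11] at hx
    have h1 : Complex.normSq (D 1 1) = Complex.normSq (D 0 0) := by
      have := mul_left_cancel₀ hs0 hx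
      rw [Complex.mul_conj, Complex.mul_conj] at this
      exact_mod_cast this
    have h2 : Complex.normSq (D 0 0) * Complex.normSq (D 1 1) = 1 := by
      rw [← map_mul]
      have : D 0 0 * D 1 1 = 1 := by linear_combination hdetD
      rw [this, map_one]
    rw [h1] at h2
    nlinarith [Complex.normSq_nonneg (D 0 0)]
  have x00' : X 0 0 = 1 := by rw [x00, Complex.mul_conj, hnorm]; simp
  have hXE : X = hermForm s := by
    ext i j
    fin_cases i <;> fin_cases j
    · simp [hermForm, x00']
    · simp [hermForm, x01]
    · simp [hermForm, x10]
    · simp [hermForm, hx, x00']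
  rw [hHX, hXE]

end Uniqueness

/-! ### Local diffeomorphisms into quadrics -/

/-- The inverse must be smooth on its whole target and not only at the image of a. The source is
therefore cut down to the open set where the differential of G is invertible. -/
theorem exists_smooth_local_inverse {E F : Type*} [NormedAddCommGroup E] [NormedSpace ℝ E]
    [CompleteSpace E] [NormedAddCommGroup F] [NormedSpace ℝ F] {G : E → F} {O : Set E}
    (hO : IsOpen O) (hG : ContDiffOn ℝ ∞ G O) {a : E} (ha : a ∈ O) (T : E ≃L[ℝ] F)
    (hT : HasFDerivAt G (T : E →L[ℝ] F) a) :
    ∃ P : OpenPartialHomeomorph E F, a ∈ P.source ∧ P.source ⊆ O ∧ (∀ x, P x = G x) ∧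
      ContDiffOn ℝ ∞ P.symm P.target := by
  have hGa : ContDiffAt ℝ ∞ G a := hG.contDiffAt (hO.mem_nhds ha)
  set P0 := hGa.toOpenPartialHomeomorph G hT (by simp)
  have hc : ContinuousOn (fderiv ℝ G) O := hG.continuousOn_fderiv_of_isOpen hO (by simp)
  set R : Set (E →L[ℝ] F) := Set.range ContinuousLinearEquiv.toContinuousLinearMap
  have hR : IsOpen R := ContinuousLinearEquiv.isOpen
  have hS : IsOpen (O ∩ fderiv ℝ G ⁻¹' R) := hc.isOpen_inter_preimage hO hR
  refine ⟨P0.restrOpen _ hS, ?_, ?_, fun x => rfl, ?_⟩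
  · rw [OpenPartialHomeomorph.restrOpen_source]
    exact ⟨hGa.mem_toOpenPartialHomeomorph_source hT (by simp), ha, by
      rw [Set.mem_preimage, hT.fderiv]; exact ⟨T, rfl⟩⟩
  · rw [OpenPartialHomeomorph.restrOpen_source]
    exact fun x hx => hx.2.1
  · intro y hy
    have hx := (P0.restrOpen _ hS).map_target hy
    rw [OpenPartialHomeomorph.restrOpen_source] at hx
    obtain ⟨T', hT'⟩ := hx.2.2
    have hGx : ContDiffAt ℝ ∞ G ((P0.restrOpen _ hS).symm y) :=
      hG.contDiffAt (hO.mem_nhds hx.2.1)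
    have hd := (hGx.differentiableAt (by simp)).hasFDerivAt
    rw [← hT'] at hd
    exact ((P0.restrOpen _ hS).contDiffAt_symm hy hd hGx).contDiffWithinAt

theorem form_smul (s r : ℝ) (x : Fin 3 → ℝ) : form s (r • x) (r • x) = r ^ 2 * form s x x := by
  simp [form]; ring

/-- A smooth map into a quadric `⟨x, x⟩ = s` that is an immersion transversal to the position
vector is a local diffeomorphism. -/
theorem isLocalDiffeoInto_of_immersion {M : Type*} [TopologicalSpace M] [ChartedSpace ℂ M]
    {N : Set (Fin 3 → ℝ)} {φ : M → Fin 3 → ℝ} {s : ℝ} (hs : s ≠ 0)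
    (hN : ∀ x ∈ N, form s x x = s) (hφ : ContMDiff 𝓘(ℝ, ℂ) 𝓘(ℝ, Fin 3 → ℝ) ∞ φ)
    (hmem : ∀ p, φ p ∈ N)
    (himm : ∀ p, ∃ e ∈ IsManifold.maximalAtlas 𝓘(ℝ, ℂ) ∞ M, p ∈ e.source ∧
      ∀ (v : ℂ) (c : ℝ), cderiv e v φ p + c • φ p = 0 → v = 0 ∧ c = 0) :
    IsLocalDiffeoInto N φ := by
  refine ⟨hφ, hmem, fun p => ?_⟩
  obtain ⟨e, he, hp, hinj⟩ := himm p
  have hsm : SmoothIn e φ := SmoothIn.of_contMDiffOn he hφ.contMDiffOn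
  -- The map is extended radially to the cone over its image, so that the inverse function theorem
  -- applies between spaces of dimension three. The differential at t = 0 is (v, c) ↦ dφ(v) + cφ.
  set G : ℂ × ℝ → Fin 3 → ℝ := fun y => (1 + y.2) • (φ ∘ e.symm) y.1 with hG
  set O : Set (ℂ × ℝ) := e.target ×ˢ Set.Ioo (-1) 1 with hOdef
  have hO : IsOpen O := e.open_target.prod isOpen_Ioo
  have hGO : ContDiffOn ℝ ∞ G O :=
    (contDiff_const.add contDiff_snd).contDiffOn.smul
      (ContDiffOn.comp (g := φ ∘ e.symm) hsm contDiff_fst.contDiffOn fun y hy => hy.1)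
  have ha : ((e p, 0) : ℂ × ℝ) ∈ O := ⟨e.map_source hp, by norm_num⟩
  have hd1 : HasFDerivAt (fun y : ℂ × ℝ => (φ ∘ e.symm) y.1)
      ((fderiv ℝ (φ ∘ e.symm) (e p)).comp (ContinuousLinearMap.fst ℝ ℂ ℝ)) (e p, 0) :=
    HasFDerivAt.comp (x := ((e p, 0) : ℂ × ℝ)) (f := Prod.fst) (g := φ ∘ e.symm)
      (hsm.differentiableAt hp).hasFDerivAt hasFDerivAt_fst
  have hd2 : HasFDerivAt (fun y : ℂ × ℝ => 1 + y.2) (ContinuousLinearMap.snd ℝ ℂ ℝ) (e p, 0) :=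
    hasFDerivAt_snd.const_add 1
  have hd := hd2.smul hd1
  set T := ((1 + ((e p, 0) : ℂ × ℝ).2) •
      ((fderiv ℝ (φ ∘ e.symm) (e p)).comp (ContinuousLinearMap.fst ℝ ℂ ℝ)) +
      (ContinuousLinearMap.snd ℝ ℂ ℝ).smulRight ((φ ∘ e.symm) ((e p, 0) : ℂ × ℝ).1)) with hT
  have hTapp : ∀ v c, T (v, c) = cderiv e v φ p + c • φ p := by
    intro v c; simp [hT, cderiv, e.left_inv hp]
  have hTinj : Function.Injective T := by
    rw [injective_iff_map_eq_zero]
    rintro ⟨v, c⟩ h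
    rw [hTapp] at h
    obtain ⟨rfl, rfl⟩ := hinj v c h
    rfl
  have hfr : Module.finrank ℝ (ℂ × ℝ) = Module.finrank ℝ (Fin 3 → ℝ) := by
    simp [Complex.finrank_real_complex]
  set T' : (ℂ × ℝ) ≃L[ℝ] (Fin 3 → ℝ) :=
    (LinearMap.linearEquivOfInjective (T : (ℂ × ℝ) →ₗ[ℝ] (Fin 3 → ℝ))
      hTinj hfr).toContinuousLinearEquiv with hT'
  have hTT' : (T' : (ℂ × ℝ) →L[ℝ] (Fin 3 → ℝ)) = T :=
    ContinuousLinearMap.ext fun _ => rfl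
  obtain ⟨P, hPa, hPO, hPG, hPs⟩ := exists_smooth_local_inverse hO hGO ha T' (by rw [hTT']; exact hd)
  have hon : ∀ x ∈ N ∩ P.target, (P.symm x).2 = 0 ∧ (P.symm x).1 ∈ e.target ∧
      φ (e.symm (P.symm x).1) = x ∧ P.symm x ∈ P.source := by
    intro x hx
    have h1 := P.map_target hx.2
    have h2 := hPO h1
    have h3 : (1 + (P.symm x).2) • φ (e.symm (P.symm x).1) = x := by
      have := P.right_inv hx.2
      rwa [hPG] at this
    have h4 := hN x hx.1
    rw [← h3, form_smul, hN _ (hmem _)] at h4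
    -- Since ⟨φ, φ⟩ = s, a point (1+t)φ on the quadric satisfies t(t+2) = 0; the bound t > -1 built
    -- into O excludes t = -2. So the quadric is the slice t = 0.
    have h5 : (P.symm x).2 = 0 := by
      have h6 : s * ((P.symm x).2 * ((P.symm x).2 + 2)) = 0 := by linear_combination h4
      rcases mul_eq_zero.1 h6 with h | h
      · exact absurd h hs
      rcases mul_eq_zero.1 h with h | h
      · exact h
      · have := h2.2.1; linarith
    refine ⟨h5, h2.1, ?_, h1⟩
    rw [h5] at h3
    simpa using h3
  have hcont : ContinuousOn (fun q => ((e q, 0) : ℂ × ℝ)) e.source :=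
    e.continuousOn.prodMk continuousOn_const
  refine ⟨e.source ∩ (fun q => ((e q, 0) : ℂ × ℝ)) ⁻¹' P.source, P.target,
    fun x => e.symm (P.symm x).1, hcont.isOpen_inter_preimage e.open_source P.open_source,
    ⟨hp, hPa⟩, P.open_target, ?_, ?_, ?_, ?_, ?_⟩
  · intro q hq
    have := P.map_source hq.2
    rw [hPG] at this
    simpa [hG, e.left_inv hq.1] using this
  · intro x hx
    obtain ⟨h1, h2, -, h4⟩ := hon x hx
    refine ⟨e.map_target h2, ?_⟩
    simp only [Set.mem_preimage, e.right_inv h2]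
    rwa [← h1]
  · refine (contMDiffOn_symm_of_mem_maximalAtlas he).comp (t := e.target)
      (contMDiffOn_iff_contDiffOn.2 (contDiff_fst.comp_contDiffOn hPs)) fun x hx => ?_
    exact (hPO (P.map_target hx)).1
  · intro q hq
    have h1 : φ q = P (e q, 0) := by rw [hPG]; simp [hG, e.left_inv hq.1]
    have h2 : P.symm (P (e q, 0)) = (e q, 0) := P.left_inv hq.2
    simp only [h1, h2, e.left_inv hq.1]
  · intro x hx
    exact (hon x hx).2.2.1

/-! ### The fundamental forms -/

section Surface

theorem lorentz_eq (ξ η : Mat2) : lorentz ξ η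
    = -(1 / 2) * (ξ 0 0 * η 1 1 + ξ 1 1 * η 0 0 - ξ 0 1 * η 1 0 - ξ 1 0 * η 0 1) := by
  unfold lorentz
  rw [Matrix.trace_fin_two]
  simp only [mul_entry, Matrix.transpose_apply]
  simp [e2]
  linear_combination -(ξ 0 0 * η 1 1 + ξ 1 1 * η 0 0 - ξ 0 1 * η 1 0 - ξ 1 0 * η 0 1)
    * Complex.I_mul_I

theorem lorentz_comm (ξ η : Mat2) : lorentz ξ η = lorentz η ξ := by
  rw [lorentz_eq, lorentz_eq]; ring

theorem lorentz_add_left (ξ ξ' η : Mat2) : lorentz (ξ + ξ') η = lorentz ξ η + lorentz ξ' η := by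
  simp only [lorentz_eq, Matrix.add_apply]; ring

theorem lorentz_smul_left (c : ℂ) (ξ η : Mat2) : lorentz (c • ξ) η = c * lorentz ξ η := by
  simp only [lorentz_eq, Matrix.smul_apply, smul_eq_mul]; ring

theorem lorentz_add_right (ξ η η' : Mat2) : lorentz ξ (η + η') = lorentz ξ η + lorentz ξ η' := by
  simp only [lorentz_eq, Matrix.add_apply]; ring

theorem lorentz_smul_right (c : ℂ) (ξ η : Mat2) : lorentz ξ (c • η) = c * lorentz ξ η := by
  simp only [lorentz_eq, Matrix.smul_apply, smul_eq_mul]; ring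

theorem lorentz_im {ξ η : Mat2} (hξ : ξᴴ = ξ) (hη : ηᴴ = η) : (lorentz ξ η).im = 0 := by
  rw [← Complex.conj_eq_iff_im, lorentz_eq]
  have h : ∀ {ζ : Mat2}, ζᴴ = ζ → ∀ i j, starRingEnd ℂ (ζ i j) = ζ j i := fun hζ i j =>
    congrFun (congrFun hζ j) i
  simp only [map_mul, map_neg, map_sub, map_add, h hξ, h hη, map_div₀, map_one, map_ofNat]
  ring

variable {M : Type*} [TopologicalSpace M] {e e' : OpenPartialHomeomorph M ℂ}

theorem mderiv_hermitian {f : M → Mat2} (hf : ∀ p, (f p)ᴴ = f p) (v : ℂ) (p : M) :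
    (mderiv e v f p)ᴴ = mderiv e v f p := by
  rw [← mderiv_conjTranspose, funext hf]

theorem real_smul_mat (r : ℝ) (A : Mat2) : r • A = (r : ℂ) • A := by
  ext i j; simp

theorem fundI_dir (f : M → Mat2) (v w : ℂ) (p : M) : fundI e f v w p =
    v.re * w.re * fundI e f 1 1 p + (v.re * w.im + v.im * w.re) * fundI e f 1 Complex.I p
      + v.im * w.im * fundI e f Complex.I Complex.I p := by
  unfold fundI
  rw [mderiv_dir v, mderiv_dir w]
  simp only [real_smul_mat, lorentz_add_left, lorentz_add_right, lorentz_smul_left,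
    lorentz_smul_right, lorentz_comm (mderiv e Complex.I f p) (mderiv e 1 f p)]
  simp
  ring

theorem fundII_dir (f n : M → Mat2) (v w : ℂ) (p : M) : fundII e f n v w p =
    v.re * w.re * fundII e f n 1 1 p + v.re * w.im * fundII e f n 1 Complex.I p
      + v.im * w.re * fundII e f n Complex.I 1 p
      + v.im * w.im * fundII e f n Complex.I Complex.I p := by
  unfold fundII
  rw [mderiv_dir v, mderiv_dir w]
  simp only [real_smul_mat, lorentz_add_left, lorentz_add_right, lorentz_smul_left,
    lorentz_smul_right]
  simp
  ring

theorem cderiv_lorentz {A B : M → Mat2} (hA : MatSmoothIn e A) (hB : MatSmoothIn e B) {p : M}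
    (hp : p ∈ e.source) (v : ℂ) : cderiv e v (fun q => lorentz (A q) (B q)) p
      = lorentz (mderiv e v A p) (B p) + lorentz (A p) (mderiv e v B p) := by
  have h : (fun q => lorentz (A q) (B q)) = fun q =>
      ((-(1 / 2)) * (A q 0 0 * B q 1 1) + (-(1 / 2)) * (A q 1 1 * B q 0 0))
      + ((1 / 2) * (A q 0 1 * B q 1 0) + (1 / 2) * (A q 1 0 * B q 0 1)) := by
    funext q; rw [lorentz_eq]; ring
  have s : ∀ (c : ℂ) i j k l, SmoothIn e fun q => c * (A q i j * B q k l) := fun c i j k l =>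
    (SmoothIn.const c).mul ((hA i j).mul (hB k l))
  have t : ∀ (c : ℂ) i j k l, cderiv e v (fun q => c * (A q i j * B q k l)) p
      = c * (mderiv e v A p i j * B p k l + A p i j * mderiv e v B p k l) := by
    intro c i j k l
    rw [cderiv_mul (SmoothIn.const c) ((hA i j).mul (hB k l)) hp, cderiv_const,
      cderiv_mul (hA i j) (hB k l) hp, zero_mul, zero_add]
    rfl
  rw [h, cderiv_add ((s _ 0 0 1 1).add (s _ 1 1 0 0)) ((s _ 0 1 1 0).add (s _ 1 0 0 1)) hp,
    cderiv_add (s _ 0 0 1 1) (s _ 1 1 0 0) hp, cderiv_add (s _ 0 1 1 0) (s _ 1 0 0 1) hp,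
    t, t, t, t, lorentz_eq, lorentz_eq]
  ring

variable {f n : M → Mat2} {K : ℝ}

section Charted

variable [ChartedSpace ℂ M]

theorem IsSurface.smoothIn_f (hf : IsSurface f n)
    (he : e ∈ IsManifold.maximalAtlas 𝓘(ℝ, ℂ) ∞ M) : MatSmoothIn e f := fun i j =>
  SmoothIn.of_contMDiffOn he (hf.smooth_f i j).contMDiffOn

theorem IsSurface.smoothIn_n (hf : IsSurface f n)
    (he : e ∈ IsManifold.maximalAtlas 𝓘(ℝ, ℂ) ∞ M) : MatSmoothIn e n := fun i j =>
  SmoothIn.of_contMDiffOn he (hf.smooth_n i j).contMDiffOn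

/-- The second fundamental form is symmetric. -/
theorem IsSurface.fundII_symm (hf : IsSurface f n)
    (he : e ∈ IsManifold.maximalAtlas 𝓘(ℝ, ℂ) ∞ M) {p : M} (hp : p ∈ e.source) (v w : ℂ) :
    fundII e f n v w p = fundII e f n w v p := by
  -- Differentiating ⟨f_v, n⟩ = 0 expresses II through the mixed second derivative of f, which is
  -- symmetric.
  have key : ∀ v w, lorentz (mderiv e v f p) (mderiv e w n p)
      = -lorentz (mderiv e w (mderiv e v f) p) (n p) := by
    intro v w
    have h := cderiv_congr_on hp (fun q hq => hf.normal_orth e he q hq v) w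
    rw [cderiv_lorentz ((hf.smoothIn_f he).mderiv v) (hf.smoothIn_n he) hp, cderiv_const] at h
    linear_combination h
  unfold fundII
  rw [key, key, mderiv_comm (hf.smoothIn_f he) hp]

/-! ### The fundamental forms under change of coordinate, and holomorphy of the transition maps. -/

theorem fundI_coordChange (he : e ∈ IsManifold.maximalAtlas 𝓘(ℝ, ℂ) ∞ M)
    (he' : e' ∈ IsManifold.maximalAtlas 𝓘(ℝ, ℂ) ∞ M) (hf : MatSmoothIn e f) {p : M}
    (hp : p ∈ e.source) (hp' : p ∈ e'.source) (v w : ℂ) :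
    fundI e' f v w p = fundI e f (fderiv ℝ (coordChange e e') (e' p) v)
      (fderiv ℝ (coordChange e e') (e' p) w) p := by
  unfold fundI
  rw [mderiv_coordChange he he' hf hp hp', mderiv_coordChange he he' hf hp hp']

theorem fundII_coordChange (he : e ∈ IsManifold.maximalAtlas 𝓘(ℝ, ℂ) ∞ M)
    (he' : e' ∈ IsManifold.maximalAtlas 𝓘(ℝ, ℂ) ∞ M) (hf : MatSmoothIn e f)
    (hn : MatSmoothIn e n) {p : M} (hp : p ∈ e.source) (hp' : p ∈ e'.source) (v w : ℂ) :
    fundII e' f n v w p = fundII e f n (fderiv ℝ (coordChange e e') (e' p) v)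
      (fderiv ℝ (coordChange e e') (e' p) w) p := by
  unfold fundII
  rw [mderiv_coordChange he he' hf hp hp', mderiv_coordChange he he' hn hp hp']

theorem IsConformalCoord.fundII_eq (hf : IsSurface f n) (he : IsConformalCoord f n e) {p : M}
    (hp : p ∈ e.source) (v w : ℂ) :
    fundII e f n v w p = (v.re * w.re + v.im * w.im) * fundII e f n 1 1 p := by
  rw [fundII_dir, hf.fundII_symm he.mem_atlas hp Complex.I 1, he.off_diag p hp, ← he.diag p hp]
  ring

theorem minkowskiCoord_comb (a b : ℝ) (X Y : Mat2) : minkowskiCoord (a • X + b • Y)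
    = a • minkowskiCoord X + b • minkowskiCoord Y := by
  ext i
  fin_cases i <;> simp [minkowskiCoord] <;> ring

theorem det_oriented_comb (r₀ r₁ X Y : Fin 4 → ℝ) (a b c d : ℝ) :
    (Matrix.of ![r₀, r₁, a • X + b • Y, c • X + d • Y]).det
      = (a * d - b * c) * (Matrix.of ![r₀, r₁, X, Y]).det := by
  have h : Matrix.of ![r₀, r₁, a • X + b • Y, c • X + d • Y]
      = !![1, 0, 0, 0; 0, 1, 0, 0; 0, 0, a, b; 0, 0, c, d] * Matrix.of ![r₀, r₁, X, Y] := by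
    ext i j
    fin_cases i <;> simp [Matrix.mul_apply, Fin.sum_univ_four]
  rw [h, Matrix.det_mul]
  congr 1
  simp [Matrix.det_succ_row_zero, Fin.sum_univ_succ, Fin.succAbove]
  ring

/-- The change between conformal coordinates is holomorphic. -/
theorem IsConformalCoord.differentiableOn_coordChange (hf : IsSurface f n)
    (he : IsConformalCoord f n e) (he' : IsConformalCoord f n e') :
    DifferentiableOn ℂ (coordChange e e') (coordDomain e e') := by
  intro z hz
  refine DifferentiableAt.differentiableWithinAt ?_
  rw [differentiableAt_complex_iff_differentiableAt_real]
  refine ⟨((contDiffOn_coordChange he.mem_atlas he'.mem_atlas).contDiffAt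
    ((isOpen_coordDomain e e').mem_nhds hz)).differentiableAt (by simp), ?_⟩
  set q := e'.symm z with hq
  have hqe : q ∈ e.source := hz.2
  have hqe' : q ∈ e'.source := e'.map_target hz.1
  have hzq : e' q = z := e'.right_inv hz.1
  have hsf := hf.smoothIn_f he.mem_atlas
  have hII := fun v w => fundII_coordChange he.mem_atlas he'.mem_atlas hsf
    (hf.smoothIn_n he.mem_atlas) hqe hqe' v w
  have hfd := fun v => (mderiv_coordChange he.mem_atlas he'.mem_atlas hsf hqe hqe' v).trans
    (mderiv_dir _ _ _)
  rw [hzq] at hII hfd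
  have h1 := he'.diag q hqe'
  have h2 := he'.off_diag q hqe'
  have hm := he.pos q hqe
  have ho := he.oriented q hqe
  have ho' := he'.oriented q hqe'
  rw [hII, hII, he.fundII_eq hf hqe, he.fundII_eq hf hqe (fderiv _ _ _ Complex.I)] at h1
  rw [hII, he.fundII_eq hf hqe] at h2
  rw [hfd, hfd, minkowskiCoord_comb, minkowskiCoord_comb, det_oriented_comb] at ho'
  set x := fderiv ℝ (coordChange e e') z 1
  set y := fderiv ℝ (coordChange e e') z Complex.I
  -- The images x, y of 1, i under the differential have equal length and are orthogonal by
  -- conformality of II, and are positively oriented by the condition on (f, n, f_x, f_y). These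
  -- force y = ix.
  have k1 := mul_right_cancel₀ hm.ne' h1
  have k2 := (mul_eq_zero.1 h2).resolve_right hm.ne'
  have k3 : 0 < x.re * y.im - x.im * y.re := pos_of_mul_pos_left ho' ho.le
  have k4 : x.re * y.im - x.im * y.re = x.re * x.re + x.im * x.im := by
    -- Lagrange's identity: det² = |x|²|y|² - ⟨x, y⟩².
    have h5 : (x.re * y.im - x.im * y.re) ^ 2 = (x.re * x.re + x.im * x.im) ^ 2 := by
      linear_combination -(x.re * x.re + x.im * x.im) * k1 - (x.re * y.re + x.im * y.im) * k2
    exact (sq_eq_sq₀ k3.le (add_nonneg (mul_self_nonneg _) (mul_self_nonneg _))).1 h5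
  -- The left side is |y - ix|², and its vanishing is the Cauchy-Riemann equation.
  have k5 : (y.re + x.im) ^ 2 + (y.im - x.re) ^ 2 = 0 := by linear_combination -k1 - 2 * k4
  have k6 : y.re + x.im = 0 := by nlinarith [sq_nonneg (y.re + x.im), sq_nonneg (y.im - x.re)]
  have k7 : y.im - x.re = 0 := by nlinarith [sq_nonneg (y.re + x.im), sq_nonneg (y.im - x.re)]
  apply Complex.ext
  · simp; linarith
  · simp; linarith

end Charted

/-! ### The coefficients of the Lax pair -/

theorem sigma_pos (hK : -1 < K) : 0 < sigma K := Real.sqrt_pos.2 (by linarith)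

theorem sigma_sq (hK : -1 < K) : sigma K ^ 2 = 1 + K := Real.sq_sqrt (by linarith)

theorem mdz_eq (A : M → Mat2) (p : M) : mdz e A p
    = (1 / 2 : ℂ) • (mderiv e 1 A p + (-Complex.I) • mderiv e Complex.I A p) := by
  ext i j; simp [mdz, dz, mderiv, sub_eq_add_neg]

theorem mdzbar_eq (A : M → Mat2) (p : M) : mdzbar e A p
    = (1 / 2 : ℂ) • (mderiv e 1 A p + Complex.I • mderiv e Complex.I A p) := by
  ext i j; simp [mdzbar, dzbar, mderiv]

theorem lorentz_mderiv (hf : ∀ p, (f p)ᴴ = f p) (v w : ℂ) (p : M) :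
    lorentz (mderiv e v f p) (mderiv e w f p) = fundI e f v w p :=
  Complex.ext rfl (lorentz_im (mderiv_hermitian hf v p) (mderiv_hermitian hf w p))

theorem klotz_eq (hf : ∀ p, (f p)ᴴ = f p) (p : M) : klotz e f p
    = (((fundI e f 1 1 p - fundI e f Complex.I Complex.I p) / 4 : ℝ) : ℂ)
      - ((fundI e f 1 Complex.I p / 2 : ℝ) : ℂ) * Complex.I := by
  unfold klotz
  rw [mdz_eq]
  simp only [lorentz_add_left, lorentz_add_right, lorentz_smul_left, lorentz_smul_right,
    lorentz_comm (mderiv e Complex.I f p) (mderiv e 1 f p), lorentz_mderiv hf]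
  push_cast
  linear_combination (1 / 4) * (fundI e f Complex.I Complex.I p : ℂ) * Complex.I_mul_I

theorem lorentz_mdz_mdzbar_f (hf : ∀ p, (f p)ᴴ = f p) (p : M) :
    (lorentz (mdz e f p) (mdzbar e f p)).re
      = (fundI e f 1 1 p + fundI e f Complex.I Complex.I p) / 4 := by
  rw [mdz_eq, mdzbar_eq]
  simp only [lorentz_add_left, lorentz_add_right, lorentz_smul_left, lorentz_smul_right,
    lorentz_comm (mderiv e Complex.I f p) (mderiv e 1 f p), lorentz_mderiv hf]
  simp
  ring

theorem lorentz_mdz_mdzbar_n (hf : ∀ p, (f p)ᴴ = f p) (hn : ∀ p, (n p)ᴴ = n p) (p : M) :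
    -(lorentz (mdz e f p) (mdzbar e n p)).re
      = (fundII e f n 1 1 p + fundII e f n Complex.I Complex.I p) / 4 := by
  rw [mdz_eq, mdzbar_eq]
  have h : ∀ v w, (lorentz (mderiv e v f p) (mderiv e w n p)).im = 0 := fun v w =>
    lorentz_im (mderiv_hermitian hf v p) (mderiv_hermitian hn w p)
  simp only [lorentz_add_left, lorentz_add_right, lorentz_smul_left, lorentz_smul_right]
  simp [fundII, h]
  ring

theorem HasConstantCurvature.det_eq [ChartedSpace ℂ M] (hK : HasConstantCurvature f n K) (hK1 : -1 < K)
    (he : IsConformalCoord f n e) {p : M} (hp : p ∈ e.source) :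
    fundII e f n 1 1 p ^ 2 = sigma K ^ 2 * (fundI e f 1 1 p * fundI e f Complex.I Complex.I p
      - fundI e f 1 Complex.I p ^ 2) ∧
    fundI e f 1 1 p * fundI e f Complex.I Complex.I p - fundI e f 1 Complex.I p ^ 2 ≠ 0 := by
  have h := hK e he.mem_atlas p hp
  unfold gaussCurvature at h
  rw [he.off_diag p hp, ← he.diag p hp] at h
  have h0 : fundI e f 1 1 p * fundI e f Complex.I Complex.I p - fundI e f 1 Complex.I p ^ 2 ≠ 0 := by
    -- Division by zero has the value 0, so a degenerate I would give K = -1, which K > -1 excludes.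
    intro hc
    rw [hc, div_zero] at h
    linarith
  refine ⟨?_, h0⟩
  rw [sigma_sq hK1]
  field_simp at h
  linear_combination h

/-- The diagonal coefficient of the Lax pair. -/
def laxD (e : OpenPartialHomeomorph M ℂ) (f n : M → Mat2) (K : ℝ) (p : M) : ℂ :=
  (1 / 4) * dz e (fun q => (uFun e f n K q : ℂ)) p + pFun e f n K p

/-- The upper off-diagonal coefficient of the Lax pair. -/
def laxA (e : OpenPartialHomeomorph M ℂ) (f n : M → Mat2) (K : ℝ) (p : M) : ℂ :=
  ((1 + sigma K) / 2 : ℂ) * Complex.I * (Real.exp (uFun e f n K p / 2) : ℂ)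

/-- The lower off-diagonal coefficient of the Lax pair. -/
def laxB (e : OpenPartialHomeomorph M ℂ) (f n : M → Mat2) (K : ℝ) (p : M) : ℂ :=
  -((1 + sigma K) / 2 : ℂ) * Complex.I * (klotz e f p * (Real.exp (-uFun e f n K p / 2) : ℂ))

/-- The ratio `(1 - σ) / (1 + σ)`. -/
def sigmaRatio (K : ℝ) : ℝ := (1 - sigma K) / (1 + sigma K)

theorem conj_dz_ofReal (u : M → ℝ) (p : M) :
    starRingEnd ℂ (dz e (fun q => (u q : ℂ)) p) = dzbar e (fun q => (u q : ℂ)) p := by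
  have h : ∀ v, starRingEnd ℂ (cderiv e v (fun q => (u q : ℂ)) p)
      = cderiv e v (fun q => (u q : ℂ)) p := by
    intro v
    rw [← cderiv_conj]
    simp only [Complex.conj_ofReal]
  simp [dz, dzbar, h, map_ofNat (starRingEnd ℂ) 2]

theorem connForm_lax (hK1 : -1 < K) (lam v : ℂ) (p : M) :
    connForm (sigmaRatio K) (laxD e f n K p) (laxA e f n K p) (laxB e f n K p) lam v
      = v • laxU e f n K lam p + starRingEnd ℂ v • laxV e f n K lam p := by
  have hσ : (1 + sigma K : ℂ) ≠ 0 := by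
    have := sigma_pos hK1
    exact_mod_cast (by positivity : (1 + sigma K : ℝ) ≠ 0)
  have hτ : ((sigmaRatio K : ℝ) : ℂ) * (1 + sigma K) = 1 - sigma K := by
    simp only [sigmaRatio]; push_cast; field_simp
  have hc : starRingEnd ℂ (laxD e f n K p)
      = (1 / 4) * dzbar e (fun q => (uFun e f n K q : ℂ)) p + starRingEnd ℂ (pFun e f n K p) := by
    simp [laxD, conj_dz_ofReal, map_ofNat (starRingEnd ℂ) 4]
  ext i j
  fin_cases i <;> fin_cases j
  · simp [connForm, hc, laxU, laxV, e1, ehat2, ehat3]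
    simp [laxD]
    ring
  · simp [connForm, laxA, laxB, laxU, laxV, e1, ehat2, ehat3, -Complex.ofReal_exp,
      map_ofNat (starRingEnd ℂ) 2]
    linear_combination (starRingEnd ℂ v * lam * Complex.I * starRingEnd ℂ (klotz e f p)
      * (Real.exp (-uFun e f n K p / 2) : ℂ) / 2) * hτ
  · simp [connForm, laxA, laxB, laxU, laxV, e1, ehat2, ehat3, -Complex.ofReal_exp,
      map_ofNat (starRingEnd ℂ) 2]
    linear_combination (-starRingEnd ℂ v * lam * Complex.I
      * (Real.exp (uFun e f n K p / 2) : ℂ) / 2) * hτ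
  · simp [connForm, hc, laxU, laxV, e1, ehat2, ehat3]
    simp [laxD]
    ring

theorem IsExtendedFrame.isLaxFrame [ChartedSpace ℂ M] {lam : ℂ} {Ψ : M → Mat2} (hK1 : -1 < K)
    (he : e ∈ IsManifold.maximalAtlas 𝓘(ℝ, ℂ) ∞ M) (h : IsExtendedFrame f n K e lam Ψ) :
    IsLaxFrame e (sigmaRatio K) (laxD e f n K) (laxA e f n K) (laxB e f n K) lam Ψ where
  smooth i j := SmoothIn.of_contMDiffOn he (h.smooth i j)
  det_eq_one := h.det_eq_one
  lax p hp v := by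
    rw [mderiv_eq_mdz_mdzbar, h.lax_z p hp, h.lax_zbar p hp, connForm_lax hK1, mul_add,
      Matrix.mul_smul, Matrix.mul_smul]

theorem laxA_ne_zero (hK1 : -1 < K) (p : M) : laxA e f n K p ≠ 0 := by
  have hσ : (1 + sigma K : ℂ) ≠ 0 := by
    have := sigma_pos hK1
    exact_mod_cast (by positivity : (1 + sigma K : ℝ) ≠ 0)
  unfold laxA
  refine mul_ne_zero (mul_ne_zero (div_ne_zero hσ two_ne_zero) Complex.I_ne_zero) ?_
  exact_mod_cast (Real.exp_pos _).ne'

theorem klotz_eq_zero_of_laxB (hK1 : -1 < K) {p : M} (h : laxB e f n K p = 0) :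
    klotz e f p = 0 := by
  have hσ : (1 + sigma K : ℂ) ≠ 0 := by
    have := sigma_pos hK1
    exact_mod_cast (by positivity : (1 + sigma K : ℝ) ≠ 0)
  have hE : (Real.exp (-uFun e f n K p / 2) : ℂ) ≠ 0 := by exact_mod_cast (Real.exp_pos _).ne'
  unfold laxB at h
  have h1 := (mul_eq_zero.1 h).resolve_left
    (mul_ne_zero (neg_ne_zero.2 (div_ne_zero hσ two_ne_zero)) Complex.I_ne_zero)
  exact (mul_eq_zero.1 h1).resolve_right hE

/-- Equality of the moduli means e^u = |Q|. With e^u = ℓ + m, where m = II(1,1)/(2σ), constant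
curvature gives |Q|² = (ℓ+m)(ℓ-m); equality would then force m(ℓ+m) = 0 although m > 0. -/
theorem norm_laxA_ne_norm_laxB [ChartedSpace ℂ M] (hf : IsSurface f n) (hK : HasConstantCurvature f n K)
    (hK1 : -1 < K) (he : IsConformalCoord f n e) {p : M} (hp : p ∈ e.source) :
    ‖laxA e f n K p‖ ≠ ‖laxB e f n K p‖ := by
  intro hab
  have hfh : ∀ p, (f p)ᴴ = f p := fun p => (hf.mem_hyperbolicSpace p).1
  have hnh : ∀ p, (n p)ᴴ = n p := fun p => hf.normal_hermitian p
  have hσ := sigma_pos hK1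
  obtain ⟨hdet, -⟩ := hK.det_eq hK1 he hp
  have hm := he.pos p hp
  have hu : uFun e f n K p = Real.log ((fundI e f 1 1 p + fundI e f Complex.I Complex.I p) / 4
      + fundII e f n 1 1 p / 2 / sigma K) := by
    unfold uFun
    rw [lorentz_mdz_mdzbar_f hfh, lorentz_mdz_mdzbar_n hfh hnh, ← he.diag p hp]
    congr 3
    ring
  have hQ : ‖klotz e f p‖ ^ 2 = ((fundI e f 1 1 p - fundI e f Complex.I Complex.I p) / 4) ^ 2
      + (fundI e f 1 Complex.I p / 2) ^ 2 := by
    rw [← Complex.normSq_eq_norm_sq, klotz_eq hfh, Complex.normSq_apply]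
    simp [-Complex.ofReal_div]
    ring
  have hexp : Real.exp (uFun e f n K p) = ‖klotz e f p‖ := by
    have h1 : ‖(1 + sigma K : ℂ) / 2‖ ≠ 0 := by
      have : (1 + sigma K : ℂ) ≠ 0 := by exact_mod_cast (by positivity : (1 + sigma K : ℝ) ≠ 0)
      simpa using this
    simp only [laxA, laxB, norm_mul, norm_neg, Complex.norm_I, mul_one, Complex.norm_real,
      Real.norm_eq_abs, Real.abs_exp] at hab
    have h2 := mul_left_cancel₀ h1 hab
    have h3 : Real.exp (uFun e f n K p)
        = Real.exp (uFun e f n K p / 2) * Real.exp (uFun e f n K p / 2) := by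
      rw [← Real.exp_add]; ring_nf
    rw [h3]
    nth_rewrite 1 [h2]
    rw [mul_assoc, ← Real.exp_add]
    ring_nf
    simp
  set ℓ := (fundI e f 1 1 p + fundI e f Complex.I Complex.I p) / 4 with hℓ
  set m := fundII e f n 1 1 p / 2 / sigma K with hmdef
  have hmpos : 0 < m := by positivity
  have hQ2 : ‖klotz e f p‖ ^ 2 = (ℓ + m) * (ℓ - m) := by
    have : m ^ 2 = (fundI e f 1 1 p * fundI e f Complex.I Complex.I p
        - fundI e f 1 Complex.I p ^ 2) / 4 := by
      rw [hmdef]; field_simp; linear_combination 4 * hdet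
    rw [hQ, hℓ]
    linear_combination this
  rw [← hexp, hu] at hQ2
  -- If ℓ + m = 0, the convention log 0 = 0 makes e^u equal to 1, which contradicts |Q|² = 0.
  -- Otherwise e^u = |ℓ + m| and only its square enters, so the sign of ℓ + m is not needed.
  by_cases hx : ℓ + m = 0
  · rw [hx] at hQ2; simp at hQ2
  · rw [Real.exp_log_eq_abs hx, sq_abs] at hQ2
    have h5 : (ℓ + m) * (2 * m) = 0 := by linear_combination hQ2
    rcases mul_eq_zero.1 h5 with h | h
    · exact hx h
    · linarith

/-! ### Umbilic surfaces -/

/-- Q = 0 says that I is a multiple of dx² + dy² in a coordinate in which II is one too;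
proportionality of the two forms does not depend on the coordinate. -/
theorem isTotallyUmbilic_of_klotz [ChartedSpace ℂ M] (hf : IsSurface f n) (hK : HasConstantCurvature f n K)
    (hK1 : -1 < K)
    (h : ∀ p, ∃ e, IsConformalCoord f n e ∧ p ∈ e.source ∧ klotz e f p = 0) :
    IsTotallyUmbilic f n := by
  intro p e' he' hp'
  obtain ⟨e, he, hp, hQ⟩ := h p
  rw [klotz_eq fun p => (hf.mem_hyperbolicSpace p).1] at hQ
  have h1 := congrArg Complex.re hQ
  have h2 := congrArg Complex.im hQ
  simp [-Complex.ofReal_div, -Complex.ofReal_sub] at h1 h2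
  obtain ⟨-, hdet⟩ := hK.det_eq hK1 he hp
  have ha : fundI e f Complex.I Complex.I p = fundI e f 1 1 p := by linarith
  have h0 : fundI e f 1 1 p ≠ 0 := by
    intro hc; apply hdet; rw [h2, hc]; ring
  refine ⟨fundII e f n 1 1 p / fundI e f 1 1 p, fun v w => ?_⟩
  rw [fundI_coordChange he.mem_atlas he' (hf.smoothIn_f he.mem_atlas) hp hp',
    fundII_coordChange he.mem_atlas he' (hf.smoothIn_f he.mem_atlas)
      (hf.smoothIn_n he.mem_atlas) hp hp', he.fundII_eq hf hp,
    fundI_dir f (fderiv ℝ (coordChange e e') (e' p) v), ha, h2]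
  field_simp
  ring

theorem isTotallyUmbilic_of_mderiv [ChartedSpace ℂ M] {F N : M → Mat2}
    (h : ∀ p, ∃ e ∈ IsManifold.maximalAtlas 𝓘(ℝ, ℂ) ∞ M, p ∈ e.source ∧ MatSmoothIn e F ∧
      MatSmoothIn e N ∧ ∃ μ : ℝ, ∀ v, mderiv e v N p = (μ : ℂ) • mderiv e v F p) :
    IsTotallyUmbilic F N := by
  intro p e' he' hp'
  obtain ⟨e, he, hp, hF, hN, μ, hμ⟩ := h p
  refine ⟨-μ, fun v w => ?_⟩
  rw [fundI_coordChange he he' hF hp hp', fundII_coordChange he he' hF hN hp hp']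
  unfold fundI fundII
  rw [hμ, lorentz_smul_right]
  simp

/-- A unitary spectral parameter and a vanishing lower coefficient give a point at which the
derivatives of the normal and of the position are proportional. -/
theorem IsLaxFrame.umbilic {τ : ℝ} {d α β : M → ℂ} {lam : ℂ} {Ψ F N : M → Mat2}
    (h : IsLaxFrame e τ d α β lam Ψ) (hl : ‖lam‖ = 1) (hτ : τ + 1 ≠ 0)
    (hF : ∀ q ∈ e.source, F q = Ψ q * (Ψ q)ᴴ) (hN : ∀ q ∈ e.source, N q = Ψ q * e1 * (Ψ q)ᴴ)
    {p : M} (hp : p ∈ e.source) (hβ : β p = 0) :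
    MatSmoothIn e F ∧ MatSmoothIn e N ∧
      ∃ μ : ℝ, ∀ v, mderiv e v N p = (μ : ℂ) • mderiv e v F p := by
  have s1 := h.smooth.mul h.smooth.conjTranspose
  have s2 := h.smooth.mul (MatSmoothIn.const e1)
  have s3 := s2.mul h.smooth.conjTranspose
  -- When β = 0 and |λ| = 1, the upper entries of W + W* and We₁ + e₁W* are (τ+1)vλ̄α and (τ-1)vλ̄α,
  -- while the diagonals vanish because that of W is imaginary. For τ = (1-σ)/(1+σ) the ratio is -σ.
  refine ⟨s1.congr hF, s3.congr hN, (τ - 1) / (τ + 1), fun v => ?_⟩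
  set W := connForm τ (d p) (α p) (β p) lam v with hW
  have hτ' : (τ : ℂ) + 1 ≠ 0 := by exact_mod_cast hτ
  have hll : lam * starRingEnd ℂ lam = 1 := by
    rw [Complex.mul_conj, Complex.normSq_eq_norm_sq, hl]; simp
  have hinv : lam⁻¹ = starRingEnd ℂ lam := inv_eq_of_mul_eq_one_right hll
  have key : W * e1 + e1 * Wᴴ = (((τ - 1) / (τ + 1) : ℝ) : ℂ) • (W + Wᴴ) := by
    have : ((τ : ℂ) + 1) • (W * e1 + e1 * Wᴴ) = ((τ : ℂ) - 1) • (W + Wᴴ) := by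
      ext i j
      simp only [Matrix.smul_apply, Matrix.add_apply, mul_entry, Matrix.conjTranspose_apply]
      fin_cases i <;> fin_cases j <;> simp [hW, connForm, e1, hβ, hinv] <;> ring
    have h2 := congrArg (fun X => ((τ : ℂ) + 1)⁻¹ • X) this
    simp only [smul_smul, inv_mul_cancel₀ hτ', one_smul] at h2
    rw [h2]
    push_cast
    rw [div_eq_inv_mul]
  rw [mderiv_congr_on hp hN, mderiv_congr_on hp hF, mderiv_mul s2 h.smooth.conjTranspose hp,
    mderiv_mul h.smooth (MatSmoothIn.const e1) hp, mderiv_mul h.smooth h.smooth.conjTranspose hp,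
    mderiv_const, mderiv_conjTranspose, h.lax p hp, ← hW, Matrix.conjTranspose_mul,
    Matrix.mul_zero, add_zero]
  have := congrArg (fun X => Ψ p * X * (Ψ p)ᴴ) key
  simpa only [Matrix.mul_add, Matrix.add_mul, Matrix.mul_smul, Matrix.smul_mul,
    Matrix.mul_assoc] using this

end Surface

/-! ### The Gauss map as a map into a quadric -/

section Quadric

variable {M : Type*} [TopologicalSpace M] {e : OpenPartialHomeomorph M ℂ}

/-- The entries of `toLieAlg s` as continuous linear maps. -/
def toLieAlgEntry (s : ℝ) (i j : Fin 2) : (Fin 3 → ℝ) →L[ℝ] ℂ :=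
  LinearMap.toContinuousLinearMap
    { toFun := fun x => toLieAlg s x i j
      map_add' := fun x y => by rw [toLieAlg_add]; rfl
      map_smul' := fun r x => by rw [toLieAlg_smul]; simp }

theorem mderiv_toLieAlg {s : ℝ} {φ : M → Fin 3 → ℝ} {A : M → Mat2} (hφ : SmoothIn e φ)
    (hA : ∀ q, toLieAlg s (φ q) = A q) {p : M} (hp : p ∈ e.source) (v : ℂ) :
    mderiv e v A p = toLieAlg s (cderiv e v φ p) := by
  ext i j
  obtain rfl : (fun q => toLieAlg s (φ q)) = A := funext hA
  exact cderiv_clm hφ hp (toLieAlgEntry s i j) v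

theorem smoothIn_lieCoord {A : M → Mat2} (hA : MatSmoothIn e A) :
    SmoothIn e fun q => lieCoord (A q) := by
  refine contDiffOn_pi.2 fun i => ?_
  fin_cases i
  exacts [(hA 0 0).clm Complex.imCLM, (hA 0 1).clm Complex.reCLM, (hA 0 1).clm Complex.imCLM]

variable {τ s : ℝ} {d α β : M → ℂ} {lam : ℂ} {Ψ A : M → Mat2} {φ : M → Fin 3 → ℝ}

/-- The Gauss map is an immersion transversal to the position vector. -/
theorem gauss_immersion (h : IsLaxFrame e τ d α β lam Ψ)
    (hA : ∀ q ∈ e.source, A q = Complex.I • (Ψ q * e1 * (Ψ q)⁻¹)) (hφ : SmoothIn e φ)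
    (hφA : ∀ q, toLieAlg s (φ q) = A q) (hs : s * s = 1) (hl : ‖lam‖ ^ 2 * τ = -s) {p : M}
    (hp : p ∈ e.source) (hαβ : ‖α p‖ ≠ ‖β p‖) (v : ℂ) (c : ℝ)
    (hvc : cderiv e v φ p + c • φ p = 0) : v = 0 ∧ c = 0 := by
  have h1 := congrArg (toLieAlg s) hvc
  have hz : toLieAlg s 0 = 0 := by
    ext i j; fin_cases i <;> fin_cases j <;> simp [toLieAlg]
  rw [toLieAlg_add, toLieAlg_smul, ← mderiv_toLieAlg hφ hφA hp, hφA, hz] at h1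
  have h2 := congrArg (fun X => X * Ψ p) h1
  simp only [Matrix.add_mul, Matrix.smul_mul, mderiv_gauss h hA hp, gauss_mul h hA hp,
    Matrix.zero_mul] at h2
  rw [smul_comm (c : ℂ), ← smul_add, ← Matrix.mul_smul, ← Matrix.mul_add] at h2
  have h3 := (smul_eq_zero.1 h2).resolve_left Complex.I_ne_zero
  rw [← Matrix.mul_zero (Ψ p)] at h3
  have h4 := h.mul_left_cancel hp h3
  -- The tangential part [W, e₁] is off-diagonal and the radial part c e₁ is diagonal, so both
  -- vanish separately.
  have h00 := congrFun (congrFun h4 0) 0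
  have h01 := congrFun (congrFun h4 0) 1
  simp only [Matrix.add_apply, Matrix.smul_apply] at h00 h01
  simp [brk, e1] at h00 h01
  exact ⟨connForm_nondegenerate hs hl hαβ h01, h00⟩

/-- dL is conjugate to i[W, e₁] by Ψ, so the pulled-back metric depends only on the off-diagonal
entries of the connection form. -/
theorem trace_mderiv_gauss (h : IsLaxFrame e τ d α β lam Ψ)
    (hA : ∀ q ∈ e.source, A q = Complex.I • (Ψ q * e1 * (Ψ q)⁻¹)) {p : M} (hp : p ∈ e.source)
    (v w : ℂ) : (mderiv e v A p * mderiv e w A p).trace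
      = 4 * (connForm τ (d p) (α p) (β p) lam v 0 1 * connForm τ (d p) (α p) (β p) lam w 1 0
        + connForm τ (d p) (α p) (β p) lam v 1 0 * connForm τ (d p) (α p) (β p) lam w 0 1) := by
  have key : ∀ v, mderiv e v A p
      = Complex.I • (Ψ p * brk (connForm τ (d p) (α p) (β p) lam v) * (Ψ p)⁻¹) := by
    intro v
    apply h.mul_right_cancel hp
    rw [mderiv_gauss h hA hp, Matrix.smul_mul, Matrix.mul_assoc, h.inv_mul hp, Matrix.mul_one]
  rw [key, key]
  set B := brk (connForm τ (d p) (α p) (β p) lam v) with hB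
  set C := brk (connForm τ (d p) (α p) (β p) lam w) with hC
  have h1 : Complex.I • (Ψ p * B * (Ψ p)⁻¹) * Complex.I • (Ψ p * C * (Ψ p)⁻¹)
      = -(Ψ p * (B * C) * (Ψ p)⁻¹) := by
    rw [Matrix.smul_mul, Matrix.mul_smul, smul_smul, Complex.I_mul_I, neg_one_smul]
    congr 1
    calc Ψ p * B * (Ψ p)⁻¹ * (Ψ p * C * (Ψ p)⁻¹)
        = Ψ p * B * ((Ψ p)⁻¹ * Ψ p) * C * (Ψ p)⁻¹ := by simp only [Matrix.mul_assoc]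
      _ = _ := by rw [h.inv_mul hp]; simp only [Matrix.mul_one, Matrix.mul_assoc]
  rw [h1, Matrix.trace_neg, Matrix.trace_mul_comm, ← Matrix.mul_assoc, h.inv_mul hp,
    Matrix.one_mul, Matrix.trace_fin_two, mul_entry, mul_entry]
  simp [hB, hC, brk]
  ring

/-- Where the Gauss map is conformal, the product of the off-diagonal coefficients vanishes. -/
theorem coeff_eq_zero_of_conformal (h : IsLaxFrame e τ d α β lam Ψ)
    (hA : ∀ q ∈ e.source, A q = Complex.I • (Ψ q * e1 * (Ψ q)⁻¹)) (hφ : SmoothIn e φ)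
    (hφA : ∀ q, toLieAlg s (φ q) = A q) (hs : s * s = 1) (hlam : lam ≠ 0) {p : M}
    (hp : p ∈ e.source)
    (h1 : form s (cderiv e 1 φ p) (cderiv e 1 φ p)
      = form s (cderiv e Complex.I φ p) (cderiv e Complex.I φ p))
    (h2 : form s (cderiv e 1 φ p) (cderiv e Complex.I φ p) = 0) : α p * β p = 0 := by
  have tr := fun v w => trace_toLieAlg_mul s hs (cderiv e v φ p) (cderiv e w φ p)
  simp only [← mderiv_toLieAlg hφ hφA hp, trace_mderiv_gauss h hA hp] at tr
  have t1 := (tr 1 1).trans ((congrArg (fun x : ℝ => ((-2 * s * x : ℝ) : ℂ)) h1).trans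
    (tr Complex.I Complex.I).symm)
  have t2 := (tr 1 Complex.I).trans (congrArg (fun x : ℝ => ((-2 * s * x : ℝ) : ℂ)) h2)
  simp [connForm] at t1 t2
  -- The combination ⟨φ_x, φ_x⟩ - ⟨φ_y, φ_y⟩ - 2i⟨φ_x, φ_y⟩ isolates the dz²-part of the pulled-back
  -- metric, to which only the dz-coefficients λ⁻¹α and λ⁻¹β contribute.
  have t3 : lam⁻¹ * lam⁻¹ * (α p * β p) = 0 := by
    linear_combination (1 / 8) * t1 - (Complex.I / 4) * t2 +
      ((1 / 4) * (lam⁻¹ * α p - lam * τ * starRingEnd ℂ (β p))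
          * (lam⁻¹ * β p - lam * τ * starRingEnd ℂ (α p))
        + (1 / 2) * (lam⁻¹ * α p * (lam⁻¹ * β p)
          - lam * τ * starRingEnd ℂ (β p) * (lam * τ * starRingEnd ℂ (α p)))) * Complex.I_mul_I
  have h5 : lam⁻¹ * lam⁻¹ ≠ 0 := mul_ne_zero (inv_ne_zero hlam) (inv_ne_zero hlam)
  exact (mul_eq_zero.1 t3).resolve_left h5

end Quadric

/-! ### The harmonic Gauss maps -/

/-- Both cases at once: the geometry enters only through the sign s in |λ₀|²τ = -s, and the choice
of a sheet matters only for s = -1. -/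
theorem exists_harmonic_gauss {M : Type*} [TopologicalSpace M] [ChartedSpace ℂ M]
    [ConnectedSpace M] {f n : M → Mat2} (hf : IsSurface f n) {K : ℝ}
    (hK : HasConstantCurvature f n K) (hK1 : -1 < K) {F N L : ℂ → M → Mat2}
    (hL : IsAssociatedFamily f n K F N L) {lam₀ : ℂ} {s : ℝ} (hs : s * s = 1)
    (hl : ‖lam₀‖ ^ 2 * sigmaRatio K = -s) {S : Set (Fin 3 → ℝ)}
    (hS : ∀ x, x ∈ S ↔ form s x x = s ∧ (s = -1 → 0 < x 0)) :
    ∃ g : Mat2, g.det = 1 ∧ ∃ φ : M → Fin 3 → ℝ,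
      (∀ p, g * L lam₀ p * g⁻¹ = toLieAlg s (φ p)) ∧
      IsLocalDiffeoInto S φ ∧ IsHarmonic f n s φ ∧
      (¬ IsTotallyUmbilic f n → ¬ IsConformal f n s φ) ∧
      (∀ lam : ℂ, ‖lam‖ = 1 → ¬ IsTotallyUmbilic (F lam) (N lam) → ¬ IsConformal f n s φ) := by
  have hs0 : s ≠ 0 := by rintro rfl; simp at hs
  have hlam₀ : lam₀ ≠ 0 := by
    rintro rfl
    rw [norm_zero] at hl
    exact hs0 (by linarith)
  choose e he hpe Ψ hΨ using hL
  have frame : ∀ p lam, lam ≠ 0 → IsLaxFrame (e p) (sigmaRatio K) (laxD (e p) f n K)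
      (laxA (e p) f n K) (laxB (e p) f n K) lam (Ψ p lam) := fun p lam h =>
    (hΨ p lam h).1.isLaxFrame hK1 (he p).mem_atlas
  have hLp : ∀ p, ∀ q ∈ (e p).source,
      L lam₀ q = Complex.I • (Ψ p lam₀ q * e1 * (Ψ p lam₀ q)⁻¹) := fun p q hq =>
    ((hΨ p lam₀ hlam₀).2 q hq).2
  have hne : ∀ p, ∀ q ∈ (e p).source, ‖laxA (e p) f n K q‖ ≠ ‖laxB (e p) f n K q‖ :=
    fun p q hq => norm_laxA_ne_norm_laxB hf hK hK1 (he p) hq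
  -- Each point carries its own coordinate and frame. The form of the frame at p is constant near p,
  -- and at a nearby q it agrees with that of the frame chosen at q because both frames represent L.
  have hconst : IsLocallyConstant fun p => Ψ p lam₀ p * hermForm s * (Ψ p lam₀ p)ᴴ := by
    rw [IsLocallyConstant.iff_eventually_eq]
    intro p
    filter_upwards [(frame p lam₀ hlam₀).herm_eventually_eq hs hl (hpe p)] with q hq
    rw [← hq.2]
    exact (herm_unique (frame p lam₀ hlam₀) (frame q lam₀ hlam₀) (hLp p) (hLp q) hs hl hq.1
      (hpe q) (hne p q hq.1)).symm
  obtain ⟨p₀⟩ : Nonempty M := inferInstance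
  have hdet₀ := (frame p₀ lam₀ hlam₀).det_eq_one p₀ (hpe p₀)
  -- This g carries the common Hermitian form to E, since gΨ is the identity at p₀.
  set g := (Ψ p₀ lam₀ p₀)⁻¹ with hg
  have hgΨ : g * Ψ p₀ lam₀ p₀ = 1 := (frame p₀ lam₀ hlam₀).inv_mul (hpe p₀)
  have hdetg : g.det = 1 := by
    have := congrArg Matrix.det hgΨ
    rwa [Matrix.det_mul, hdet₀, mul_one, Matrix.det_one] at this
  have hherm : ∀ p, (g * Ψ p lam₀ p) * hermForm s * (g * Ψ p lam₀ p)ᴴ = hermForm s := by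
    intro p
    have h1 := hconst.apply_eq_of_preconnectedSpace p p₀
    have h2 := congrArg (fun X => g * X * gᴴ) h1
    calc (g * Ψ p lam₀ p) * hermForm s * (g * Ψ p lam₀ p)ᴴ
        = g * (Ψ p lam₀ p * hermForm s * (Ψ p lam₀ p)ᴴ) * gᴴ := by
          rw [Matrix.conjTranspose_mul]; simp only [Matrix.mul_assoc]
      _ = g * (Ψ p₀ lam₀ p₀ * hermForm s * (Ψ p₀ lam₀ p₀)ᴴ) * gᴴ := h2
      _ = (g * Ψ p₀ lam₀ p₀) * hermForm s * (g * Ψ p₀ lam₀ p₀)ᴴ := by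
          rw [Matrix.conjTranspose_mul]; simp only [Matrix.mul_assoc]
      _ = hermForm s := by rw [hgΨ]; simp
  set A : M → Mat2 := fun p => g * L lam₀ p * g⁻¹ with hA
  have hframe := fun p => (frame p lam₀ hlam₀).const_mul hdetg
  have hAp : ∀ p, ∀ q ∈ (e p).source,
      A q = Complex.I • ((g * Ψ p lam₀ q) * e1 * (g * Ψ p lam₀ q)⁻¹) := by
    intro p q hq
    simp only [hA, hLp p q hq, Matrix.mul_inv_rev, Matrix.mul_smul, Matrix.smul_mul,
      Matrix.mul_assoc]
  have hquad := fun p => unitary_gauss ((hframe p).det_eq_one p (hpe p)) (hherm p)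
  set φ : M → Fin 3 → ℝ := fun p => lieCoord (A p) with hφ
  have hφA : ∀ p, toLieAlg s (φ p) = A p := by
    intro p
    obtain ⟨h1, h2, -, -⟩ := hquad p
    rw [← hAp p p (hpe p)] at h1 h2
    exact toLieAlg_lieCoord h1 h2
  have hφs : ∀ p, SmoothIn (e p) φ := fun p => smoothIn_lieCoord (smooth_gauss (hframe p) (hAp p))
  have hφM : ContMDiff 𝓘(ℝ, ℂ) 𝓘(ℝ, Fin 3 → ℝ) ∞ φ := fun p =>
    ((hφs p).contMDiffOn (he p).mem_atlas).contMDiffAt ((e p).open_source.mem_nhds (hpe p))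
  have hmem : ∀ p, φ p ∈ S := by
    intro p
    rw [hS]
    constructor
    · obtain ⟨-, -, h3, -⟩ := hquad p
      rw [← hAp p p (hpe p), ← hφA, det_toLieAlg hs] at h3
      have h4 : s * form s (φ p) (φ p) = 1 := by exact_mod_cast h3
      exact mul_left_cancel₀ hs0 (h4.trans hs.symm)
    · rintro rfl
      have := hyperbolic_gauss_pos ((hframe p).det_eq_one p (hpe p)) (hherm p)
      rwa [← hAp p p (hpe p)] at this
  have hconf : IsConformal f n s φ → ∀ p, laxB (e p) f n K p = 0 := by
    intro hc p
    obtain ⟨h1, h2⟩ := hc (e p) (he p) p (hpe p)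
    exact (mul_eq_zero.1 (coeff_eq_zero_of_conformal (hframe p) (hAp p) (hφs p) hφA hs hlam₀
      (hpe p) h1 h2)).resolve_left (laxA_ne_zero hK1 p)
  refine ⟨g, hdetg, φ, fun p => (hφA p).symm, ?_, ?_, ?_, ?_⟩
  · exact isLocalDiffeoInto_of_immersion hs0 (fun x hx => ((hS x).1 hx).1) hφM hmem fun p =>
      ⟨e p, (he p).mem_atlas, hpe p,
        gauss_immersion (hframe p) (hAp p) (hφs p) hφA hs hl (hpe p) (hne p p (hpe p))⟩
  · intro e' he' p hp' X hX
    -- Harmonicity is required in every conformal coordinate e', but is computed in the one that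
    -- carries the frame; the Laplacians differ by a factor.
    obtain ⟨r, hr⟩ := laplacian_coordChange (hφs p) (hpe p) hp'
      ((he p).differentiableOn_coordChange hf he')
    -- The coefficients do not depend on λ, so their smoothness and holomorphy come from the frames
    -- at λ = 1 and λ = 2, not from those at λ₀.
    obtain ⟨hd, hα, hβ⟩ := (frame p 1 one_ne_zero).smooth_coeff
    obtain ⟨κ, hκ⟩ := laplacian_gauss (hframe p) (hAp p) hd hα hβ (hpe p)
      ((frame p 1 one_ne_zero).holomorphic (frame p 2 two_ne_zero) (hpe p)) hs hl
    have hsec : ∀ v, mderiv (e p) v (mderiv (e p) v A) p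
        = toLieAlg s (cderiv (e p) v (cderiv (e p) v φ) p) := by
      intro v
      rw [mderiv_congr_on (hpe p) fun q hq => mderiv_toLieAlg (hφs p) hφA hq v]
      exact mderiv_toLieAlg ((hφs p).cderiv v) (fun _ => rfl) (hpe p) v
    rw [hsec, hsec, ← toLieAlg_add, ← hφA, ← toLieAlg_smul] at hκ
    have hlap : laplacian (e p) φ p = κ • φ p := toLieAlg_injective s hκ
    rw [hr, hlap]
    simp only [form, Pi.smul_apply, smul_eq_mul] at hX ⊢
    linear_combination (r * κ) * hX
  · intro hu hc
    exact hu (isTotallyUmbilic_of_klotz hf hK hK1 fun p =>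
      ⟨e p, he p, hpe p, klotz_eq_zero_of_laxB hK1 (hconf hc p)⟩)
  · intro lam hlam hu hc
    have hlam0 : lam ≠ 0 := by rintro rfl; simp at hlam
    have hτ : sigmaRatio K + 1 ≠ 0 := by
      have hσ := sigma_pos hK1
      have : sigmaRatio K + 1 = 2 / (1 + sigma K) := by unfold sigmaRatio; field_simp; ring
      rw [this]
      positivity
    refine hu (isTotallyUmbilic_of_mderiv fun p => ⟨e p, (he p).mem_atlas, hpe p, ?_⟩)
    exact (frame p lam hlam0).umbilic hlam hτ
      (fun q hq => (((hΨ p lam hlam0).2 q hq).1 hlam).1)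
      (fun q hq => (((hΨ p lam hlam0).2 q hq).1 hlam).2) (hpe p) (hconf hc p)

/-! ### The two critical radii. -/

/-- With x² = -1/K one has x² - 1 = σ²x², so exp(arcosh x) = x + √(x² - 1) = (1+σ)x. Its square is
(1+σ)²/(1-σ²) = 1/τ. -/
theorem norm_sq_mul_sigmaRatio_of_neg {K : ℝ} (hK1 : -1 < K) (hK : K < 0) {r : ℝ}
    (hr : r = Real.exp (Real.arcosh √(-1 / K))) : r ^ 2 * sigmaRatio K = 1 := by
  have hσ := sigma_pos hK1
  have hσ2 := sigma_sq hK1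
  have hKne := hK.ne
  have h0 : 0 < -1 / K := div_pos_of_neg_of_neg (by norm_num) hK
  have h1 : 1 ≤ √(-1 / K) := by
    rw [Real.one_le_sqrt, le_div_iff_of_neg hK]; linarith
  have hq : 0 < √(-1 / K) := by linarith
  rw [Real.exp_arcosh h1, Real.sq_sqrt h0.le] at hr
  have h2 : √(-1 / K - 1) = sigma K * √(-1 / K) := by
    rw [show -1 / K - 1 = sigma K ^ 2 * (-1 / K) by rw [hσ2]; field_simp; ring,
      Real.sqrt_mul (by positivity), Real.sqrt_sq hσ.le]
  rw [h2] at hr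
  have h3 : r ^ 2 = (1 + sigma K) ^ 2 * (-1 / K) := by
    rw [hr]; linear_combination (1 + sigma K) ^ 2 * Real.sq_sqrt h0.le
  rw [h3, sigmaRatio]
  field_simp
  linear_combination hσ2

/-- With x² = 1/K one has 1 + x² = σ²x², so exp(arsinh x) = (1+σ)x, with square (1+σ)²/(σ²-1) =
-1/τ. -/
theorem norm_sq_mul_sigmaRatio_of_pos {K : ℝ} (hK : 0 < K) {r : ℝ}
    (hr : r = Real.exp (Real.arsinh √(1 / K))) : r ^ 2 * sigmaRatio K = -1 := by
  have hK1 : -1 < K := by linarith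
  have hσ := sigma_pos hK1
  have hσ2 := sigma_sq hK1
  have h0 : 0 < 1 / K := by positivity
  have hq : 0 < √(1 / K) := by positivity
  rw [Real.exp_arsinh, Real.sq_sqrt h0.le] at hr
  have h2 : √(1 + 1 / K) = sigma K * √(1 / K) := by
    rw [show 1 + 1 / K = sigma K ^ 2 * (1 / K) by rw [hσ2]; field_simp; ring,
      Real.sqrt_mul (by positivity), Real.sqrt_sq hσ.le]
  rw [h2] at hr
  have h3 : r ^ 2 = (1 + sigma K) ^ 2 * (1 / K) := by
    rw [hr]; linear_combination (1 + sigma K) ^ 2 * Real.sq_sqrt h0.le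
  rw [h3, sigmaRatio]
  field_simp
  linear_combination -hσ2

end CGC

end

theorem theoremB {M : Type*} [TopologicalSpace M] [ChartedSpace ℂ M]
    [IsManifold 𝓘(ℝ, ℂ) ∞ M] [ConnectedSpace M]
    (f n : M → CGC.Mat2) (hf : CGC.IsSurface f n)
    (K : ℝ) (hK : CGC.HasConstantCurvature f n K) (hK1 : -1 < K) (hK0 : K ≠ 0)
    (F N L : ℂ → M → CGC.Mat2) (hL : CGC.IsAssociatedFamily f n K F N L) (lam₀ : ℂ) :
    (K < 0 → ‖lam₀‖ = Real.exp (Real.arcosh √(-1 / K)) →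
      ∃ g : CGC.Mat2, g.det = 1 ∧ ∃ φ : M → Fin 3 → ℝ,
        (∀ p, g * L lam₀ p * g⁻¹ = CGC.toLieAlg (-1) (φ p)) ∧
        CGC.IsLocalDiffeoInto CGC.H2 φ ∧
        CGC.IsHarmonic f n (-1) φ ∧
        (¬ CGC.IsTotallyUmbilic f n → ¬ CGC.IsConformal f n (-1) φ) ∧
        (∀ lam : ℂ, ‖lam‖ = 1 → ¬ CGC.IsTotallyUmbilic (F lam) (N lam) →
          ¬ CGC.IsConformal f n (-1) φ)) ∧
    (0 < K → ‖lam₀‖ = Real.exp (Real.arsinh √(1 / K)) →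
      ∃ g : CGC.Mat2, g.det = 1 ∧ ∃ φ : M → Fin 3 → ℝ,
        (∀ p, g * L lam₀ p * g⁻¹ = CGC.toLieAlg 1 (φ p)) ∧
        CGC.IsLocalDiffeoInto CGC.S2 φ ∧
        CGC.IsHarmonic f n 1 φ ∧
        (¬ CGC.IsTotallyUmbilic f n → ¬ CGC.IsConformal f n 1 φ) ∧
        (∀ lam : ℂ, ‖lam‖ = 1 → ¬ CGC.IsTotallyUmbilic (F lam) (N lam) →
          ¬ CGC.IsConformal f n 1 φ)) := by
  refine ⟨fun hneg h => ?_, fun hpos h => ?_⟩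
  · refine CGC.exists_harmonic_gauss hf hK hK1 hL (by norm_num) ?_ fun x => ?_
    · rw [CGC.norm_sq_mul_sigmaRatio_of_neg hK1 hneg h, neg_neg]
    · simp [CGC.H2]
  · refine CGC.exists_harmonic_gauss hf hK hK1 hL (by norm_num) ?_ fun x => ?_
    · exact CGC.norm_sq_mul_sigmaRatio_of_pos hpos h
    · norm_num [CGC.S2]
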